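/- Theorem (Properties of $\Phi^{\mathcal N},\Phi^{\mathcal C},\Phi^{\mathcal S}$). Let $b\ge 2$ be an integer, $0<p\le\infty$, $L^p=L^p([0,1))$ (real-valued, Lebesgue measure), and let $S\subset L^p$ be a finite-dimensional linear subspace that is closed under $b$-adic dilation, i.e. $f(b^{-1}(\cdot+k))\in S$ for all $f\in S$ and $0\le k<b$. Fix a basis $\varphi_1,\dots,\varphi_m$ of $S$, $m=\dim S$. A tensor network $\mathbf v$ of level $d\ge1$ with ranks $r_1,\dots,r_d\in\mathbb N_0$ is a tuple $\mathbf v=(v_1,\dots,v_{d+1})$ of real arrays $v_1\in\mathbb R^{b\times r_1}$, $v_\nu\in\mathbb R^{b\times r_{\nu-1}\times r_\nu}$ for $2\le\nu\le d$, and $v_{d+1}\in\mathbb R^{r_d\times m}$. It realizes the function $f\in L^p$ given, for $i_1,\dots,i_d\in\{0,\dots,b-1\}$ and a.e. $y\in[0,1)$, by $$f\Big(\sum_{k=1}^d i_kb^{-k}+b^{-d}y\Big)=\sum_{k_1=1}^{r_1}\cdots\sum_{k_d=1}^{r_d}\sum_{q=1}^{m}v_1^{k_1}(i_1)\,v_2^{k_1,k_2}(i_2)\cdots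 v_d^{k_{d-1},k_d}(i_d)\,v_{d+1}^{k_d,q}\,\varphi_q(y)$$ (an empty sum is $0$). Put $$\mathrm{cost}_{\mathcal N}(\mathbf v)=\sum_{\nu=1}^d r_\nu,\qquad \mathrm{cost}_{\mathcal C}(\mathbf v)=br_1+b\sum_{\nu=2}^d r_{\nu-1}r_\nu+r_d\,m,\qquad \mathrm{cost}_{\mathcal S}(\mathbf v)=\sum_{\nu=1}^{d+1}\|v_\nu\|_{\ell^0},$$ where $\|v_\nu\|_{\ell^0}$ is the number of non-zero entries of $v_\nu$. For $n\in\mathbb N_0$ and $\bullet\in\{\mathcal N,\mathcal C,\mathcal S\}$ let $\Phi_n^{\bullet}\subset L^p$ be the set of all functions realized by some tensor network $\mathbf v$, of any level $d\ge 1$ and any ranks, with $\mathrm{cost}_\bullet(\mathbf v)\le n$. Then the following hold. (i) Each of the three families $(\Phi_n)_{n\ge0}=(\Phi_n^{\mathcal N})_n,(\Phi_n^{\mathcal C})_n,(\Phi_n^{\mathcal S})_n$ satisfies: (P1) $0\in\Phi_n$ for all $n$, and $\Phi_0=\{0\}$; (P2) $\Phi_n\subset\Phi_{n+1}$ for all $n$;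 (P3) $a\Phi_n=\Phi_n$ for all $a\in\mathbb R\setminus\{0\}$ and all $n$; (P4) there is a constant $c\in\mathbb N_0$, independent of $n$, with $\Phi_n+\Phi_n\subset\Phi_{cn}$ for all $n$. (ii) If $1\le p\le\infty$, then for every $n\ge 0$ the sets $\Phi_n^{\mathcal N}$ and $\Phi_n^{\mathcal C}$ are proximinal in $L^p$ (P6): every $f\in L^p$ has a best approximation in them. (iii) If $1\le p<\infty$ and $S$ contains the constant function $1$, then each of $\bigcup_n\Phi_n^{\mathcal N}$, $\bigcup_n\Phi_n^{\mathcal C}$, $\bigcup_n\Phi_n^{\mathcal S}$ is dense in $L^p$ (P5). Consequently, for all $\alpha>0$ and $0<q\le\infty$ and each of the three families $(\Phi_n)_n$, with $E_n(f)=\inf_{\varphi\in\Phi_n}\|f-\varphi\|_p$ and $$\|f\|_{A^\alpha_q}=\Big(\sum_{n=1}^\infty [n^\alpha E_{n-1}(f)]^q\tfrac1n\Big)^{1/q}\ (q<\infty),\qquad \|f\|_{A^\alpha_\infty}=\sup_{n\ge1}n^\alpha E_{n-1}(f),$$ the approximation class $\{f\in L^p:\|f\|_{A^\alpha_q}<\infty\}$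 (denoted $N^\alpha_q$, $C^\alpha_q$, $S^\alpha_q$, respectively) is a linear subspace of $L^p$ on which $\|\cdot\|_{A^\alpha_q}$ is a quasi-norm. -/

import Mathlib

open MeasureTheory
open scoped ENNReal NNReal Pointwise

namespace TTApprox

/-! ### Approximation tools and approximation classes -/

section General

/-- (P1) `0 ∈ Φ n` for all `n`, and `Φ 0 = {0}`. -/
def P1 {X : Type*} [Zero X] (Φ : ℕ → Set X) : Prop :=
  (∀ n, (0 : X) ∈ Φ n) ∧ Φ 0 = {0}

/-- (P2) `Φ n ⊆ Φ (n + 1)`. -/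
def P2 {X : Type*} (Φ : ℕ → Set X) : Prop :=
  ∀ n, Φ n ⊆ Φ (n + 1)

/-- (P3) `a • Φ n = Φ n` for all real `a ≠ 0`. -/
def P3 {X : Type*} [SMul ℝ X] (Φ : ℕ → Set X) : Prop :=
  ∀ a : ℝ, a ≠ 0 → ∀ n, a • Φ n = Φ n

/-- (P4) `Φ n + Φ n ⊆ Φ (c n)` with a constant `c` that does not depend on `n`. -/
def P4 {X : Type*} [Add X] (Φ : ℕ → Set X) : Prop :=
  ∃ c : ℕ, ∀ n, Φ n + Φ n ⊆ Φ (c * n)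

/-- (P5) The union of all `Φ n` is dense. -/
def P5 {X : Type*} [TopologicalSpace X] (Φ : ℕ → Set X) : Prop :=
  Dense (⋃ n, Φ n)

/-- (P6) Every `Φ n` is proximinal: each `f` has a best approximation in `Φ n`. -/
def P6 {X : Type*} [Norm X] [Sub X] (Φ : ℕ → Set X) : Prop :=
  ∀ n, ∀ f : X, ∃ φ ∈ Φ n, ∀ ψ ∈ Φ n, ‖f - φ‖ ≤ ‖f - ψ‖

/-- The best approximation error `E_n(f) = inf_{φ ∈ Φ n} ‖f - φ‖`, with values in `[0, ∞]`. -/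
noncomputable def bestError {X : Type*} [ENorm X] [Sub X] (Φ : ℕ → Set X) (n : ℕ) (f : X) :
    ℝ≥0∞ :=
  ⨅ φ ∈ Φ n, ‖f - φ‖ₑ

/-- `(∑_{n ≥ 1} [n^α E_{n-1}(f)]^q / n)^{1/q}` for `q < ∞` and `sup_{n ≥ 1} n^α E_{n-1}(f)` for
`q = ∞`. The index below is shifted by one: it runs over `n - 1`. -/
noncomputable def approxNorm {X : Type*} [ENorm X] [Sub X] (Φ : ℕ → Set X) (α : ℝ) (q : ℝ≥0∞)
    (f : X) : ℝ≥0∞ :=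
  if q = ∞ then ⨆ n : ℕ, ((n + 1 : ℕ) : ℝ≥0∞) ^ α * bestError Φ n f
  else (∑' n : ℕ, (((n + 1 : ℕ) : ℝ≥0∞) ^ α * bestError Φ n f) ^ q.toReal
    / ((n + 1 : ℕ) : ℝ≥0∞)) ^ (1 / q.toReal)

/-- The approximation class `A^α_q(X, Φ)`. -/
def approxClass {X : Type*} [ENorm X] [Sub X] (Φ : ℕ → Set X) (α : ℝ) (q : ℝ≥0∞) : Set X :=
  {f | approxNorm Φ α q f < ∞}

/-- `A` is a linear subspace of `X` and `N` restricts to a (finite) quasi-norm on it. -/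
def IsQuasiNormedSpace {X : Type*} [AddCommGroup X] [Module ℝ X] (A : Set X) (N : X → ℝ≥0∞) :
    Prop :=
  (∃ V : Submodule ℝ X, (V : Set X) = A) ∧
  (∀ f ∈ A, N f < ∞) ∧
  (∀ f ∈ A, N f = 0 ↔ f = 0) ∧
  (∀ a : ℝ, ∀ f ∈ A, N (a • f) = ‖a‖ₑ * N f) ∧
  ∃ K : ℝ≥0, ∀ f ∈ A, ∀ g ∈ A, N (f + g) ≤ K * (N f + N g)

end General

/-! ### Tensorization of functions on `[0,1)` -/

/-- Lebesgue measure on `[0,1)`. -/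
noncomputable abbrev lam : Measure ℝ := volume.restrict (Set.Ico (0 : ℝ) 1)

/-- The real space `L^p([0,1))`, `0 < p ≤ ∞` (classes of functions modulo null sets). -/
noncomputable abbrev LpI (p : ℝ≥0∞) : AddSubgroup (ℝ →ₘ[lam] ℝ) := Lp ℝ p lam

/-- The conversion map `t_{b,d}(i_1,…,i_d,y) = ∑_k i_k b^{-k} + b^{-d} y`. -/
noncomputable def conv (b d : ℕ) (i : Fin d → Fin b) (y : ℝ) : ℝ :=
  (∑ k : Fin d, ((i k : ℕ) : ℝ) / (b : ℝ) ^ ((k : ℕ) + 1)) + y / (b : ℝ) ^ d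

/-- The tensorization `T_{b,d} f (i_1,…,i_d,y) = f (t_{b,d}(i_1,…,i_d,y))`. -/
noncomputable def tensorize (b d : ℕ) (f : ℝ → ℝ) (i : Fin d → Fin b) (y : ℝ) : ℝ :=
  f (conv b d i y)

/-- `S` is closed under `b`-adic dilation: for `f ∈ S` and `0 ≤ k < b`, the function
`y ↦ f (b⁻¹ (y + k))` on `[0,1)` belongs to `S`. -/
def ClosedUnderDilation (b : ℕ) {p : ℝ≥0∞} (S : Submodule ℝ (LpI p)) : Prop :=
  ∀ f ∈ S, ∀ k < b, ∃ g ∈ S, (fun y : ℝ => f ((b : ℝ)⁻¹ * (y + (k : ℝ)))) =ᵐ[lam] g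

/-! ### Tensor networks in tensor train format -/

/-- A tensor train network with base `b`, level `d = l + 1 ≥ 1`, ranks `r_1, …, r_d` (here
`rank 0, …, rank l`), and a feature space of dimension `m`. The parameters are
`v_1 ∈ ℝ^{b × r_1}`, `v_ν ∈ ℝ^{b × r_{ν-1} × r_ν}` for `2 ≤ ν ≤ d`, and
`v_{d+1} ∈ ℝ^{r_d × m}`. Ranks may be zero (empty sums), which gives the zero function. -/
structure TensorNetwork (b m : ℕ) where
  l : ℕ
  rank : Fin (l + 1) → ℕ
  first : Fin b → Fin (rank 0) → ℝ
  core : (ν : Fin l) → Fin b → Fin (rank ν.castSucc) → Fin (rank ν.succ) → ℝ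
  last : Fin (rank (Fin.last l)) → Fin m → ℝ

namespace TensorNetwork

variable {b m : ℕ}

/-- The level `d` of a network. -/
def level (v : TensorNetwork b m) : ℕ := v.l + 1

/-- The tensor
`∑_{k_1,…,k_d} ∑_q v_1^{k_1}(i_1) v_2^{k_1,k_2}(i_2) ⋯ v_d^{k_{d-1},k_d}(i_d) v_{d+1}^{k_d,q} φ_q(y)`
represented by the network. -/
noncomputable def tensor (v : TensorNetwork b m) (φ : Fin m → ℝ → ℝ)
    (i : Fin v.level → Fin b) (y : ℝ) : ℝ :=
  ∑ k : ((ν : Fin (v.l + 1)) → Fin (v.rank ν)), ∑ q : Fin m,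
    v.first (i (0 : Fin (v.l + 1))) (k 0) *
      (∏ ν : Fin v.l, v.core ν (i (Fin.succ ν)) (k ν.castSucc) (k ν.succ)) *
      v.last (k (Fin.last v.l)) q * φ q y

/-- `f ∈ L^p` is the function realized by the network `v`: the tensorization of `f` at the level
of `v` is (almost everywhere) the tensor represented by `v`. -/
def Realizes {p : ℝ≥0∞} (v : TensorNetwork b m) (φ : Fin m → LpI p) (f : LpI p) : Prop :=
  ∀ i : Fin v.level → Fin b, tensorize b v.level f i =ᵐ[lam] v.tensor (fun q => φ q) i

/-- The sum of ranks `∑_ν r_ν`. -/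
def costN (v : TensorNetwork b m) : ℕ := ∑ ν, v.rank ν

/-- The number of parameters `b r_1 + b ∑_{ν=2}^d r_{ν-1} r_ν + r_d m`. -/
def costC (v : TensorNetwork b m) : ℕ :=
  b * v.rank 0 + b * (∑ ν : Fin v.l, v.rank ν.castSucc * v.rank ν.succ)
    + v.rank (Fin.last v.l) * m

/-- The number of non-zero parameters `∑_{ν=1}^{d+1} ‖v_ν‖_{ℓ⁰}`. -/
noncomputable def costS (v : TensorNetwork b m) : ℕ :=
  Nat.card {e : Fin b × Fin (v.rank 0) // v.first e.1 e.2 ≠ 0}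
    + (∑ ν : Fin v.l, Nat.card
        {e : Fin b × Fin (v.rank ν.castSucc) × Fin (v.rank ν.succ) //
          v.core ν e.1 e.2.1 e.2.2 ≠ 0})
    + Nat.card {e : Fin (v.rank (Fin.last v.l)) × Fin m // v.last e.1 e.2 ≠ 0}

end TensorNetwork

/-- The functions in `L^p` realized by some tensor network (of any level `d ≥ 1` and any ranks)
whose cost is at most `n`. -/
def Phi {b m : ℕ} {p : ℝ≥0∞} (cost : TensorNetwork b m → ℕ) (φ : Fin m → LpI p) (n : ℕ) :
    Set (LpI p) :=
  {f | ∃ v : TensorNetwork b m, cost v ≤ n ∧ v.Realizes φ f}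

section Tools

variable (b : ℕ) {p : ℝ≥0∞} {S : Submodule ℝ (LpI p)}
  (φ : Module.Basis (Fin (Module.finrank ℝ S)) ℝ S)

/-- `Φ_n^N`: tensor networks over `S` whose sum of ranks is at most `n`. -/
def PhiN (n : ℕ) : Set (LpI p) :=
  Phi (b := b) TensorNetwork.costN (fun q => (φ q : LpI p)) n

/-- `Φ_n^C`: tensor networks over `S` with at most `n` parameters. -/
def PhiC (n : ℕ) : Set (LpI p) :=
  Phi (b := b) TensorNetwork.costC (fun q => (φ q : LpI p)) n

/-- `Φ_n^S`: tensor networks over `S` with at most `n` non-zero parameters, where the parameters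
of the last core are coefficients with respect to the basis `φ` of `S`. -/
def PhiS (n : ℕ) : Set (LpI p) :=
  Phi (b := b) TensorNetwork.costS (fun q => (φ q : LpI p)) n

end Tools

end TTApprox

namespace TTApprox

/-! ### Dilation operators on `L^p([0,1))` -/

/-! Cutting [0,1) into b equal intervals identifies L^p with (L^p)^b through the dilations D_k f =
f(b⁻¹(· + k)) (`dil_injective`, `exists_dil_eq`). A network of level d therefore realizes f exactly
when there are families g_1, …, g_d of r_1, …, r_d functions such that every D_i f is a combination
of g_1, every dilation of a member of g_ν is a combination of g_{ν+1}, and g_d lies in S, with the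
cores as coefficients (`TensorNetwork.realizes_of_chain`, `TensorNetwork.Realizes.exists_chain`).

Hence r_ν is at least the dimension of the span of the ν-fold dilations of f, and bases of these
spans attain all the minima at once. For a cost that is monotone in the ranks, membership in Φ_n
becomes a condition on f alone (`RankCost.mem_Phi_iff`). Minimal ranks are subadditive, they stay at
most m when the level is raised because S is closed under dilation, and they are positive for f ≠ 0,
so the level is bounded by the cost. This gives (P1), (P3) and (P4); for the cost C, the growth
bound r_{ν+1} ≤ b r_ν makes the cost comparable to ∑ r_ν², which disposes of mixed products. Minimal
ranks are lower semicontinuous and Φ_n sits in a finite-dimensional space, so Φ_n is closed and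
proximinal (`RankCost.p6`).

Sparsity is not a function of the ranks. There the chains themselves are manipulated: sums use block
diagonal cores (`SparseChain.append`), and levels are raised by expanding the dilations of the basis
of S in that basis (`SparseChain.extend`). Density comes from b-adic step functions, whose dilations
are eventually constant (`dense_iUnion_Phi`). Finally, (P4) bounds E_{cn}(f + g) by a multiple of
E_n(f) + E_n(g), and k ↦ ⌊k/c⌋ takes each value c times, so the weighted sums satisfy a
quasi-triangle inequality (`exists_approxNorm_add_le`). -/

lemma map_affine_restrict_le (a c : ℝ) (ha : a ≠ 0) {A B : Set ℝ}
    (hAB : Set.MapsTo (fun x => a * x + c) A B) :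
    (volume.restrict A).map (fun x => a * x + c) ≤ ENNReal.ofReal |a⁻¹| • volume.restrict B := by
  refine Measure.le_iff.2 fun s hs => ?_
  have hm : Measurable fun x : ℝ => a * x + c := by fun_prop
  rw [Measure.map_apply hm hs, Measure.restrict_apply (hm hs), Measure.smul_apply,
    Measure.restrict_apply hs, smul_eq_mul]
  calc volume ((fun x => a * x + c) ⁻¹' s ∩ A)
      ≤ volume ((fun x => a * x) ⁻¹' ((fun x => x + c) ⁻¹' (s ∩ B))) :=
        measure_mono fun x hx => ⟨hx.1, hAB hx.2⟩
    _ = _ := by rw [Real.volume_preimage_mul_left ha, measure_preimage_add_right]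

lemma quasiMeasurePreserving_of_map_le_smul {f : ℝ → ℝ} (hf : Measurable f) {μ ν : Measure ℝ}
    {c : ℝ≥0∞} (h : μ.map f ≤ c • ν) : Measure.QuasiMeasurePreserving f μ ν :=
  ⟨hf, h.absolutelyContinuous.trans Measure.smul_absolutelyContinuous⟩

/-- The inverse branch `y ↦ b⁻¹ (y + k)` of `x ↦ b x mod 1`. -/
noncomputable def branch (b k : ℕ) (y : ℝ) : ℝ := (b : ℝ)⁻¹ * (y + (k : ℝ))

/-- The `b`-adic interval `[k/b, (k+1)/b)`. -/
def adicInterval (b k : ℕ) : Set ℝ := Set.Ico ((k : ℝ) / b) (((k : ℝ) + 1) / b)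

lemma measurable_branch (b k : ℕ) : Measurable (branch b k) := by
  unfold branch; fun_prop

lemma measurableSet_adicInterval (b k : ℕ) : MeasurableSet (adicInterval b k) :=
  measurableSet_Ico

section

variable {b : ℕ} [NeZero b]

lemma cast_base_pos : (0 : ℝ) < b := Nat.cast_pos.2 (NeZero.pos b)

lemma branch_mem_adicInterval (k : ℕ) {y : ℝ} (hy : y ∈ Set.Ico (0 : ℝ) 1) :
    branch b k y ∈ adicInterval b k := by
  have hb : (0 : ℝ) < b := cast_base_pos
  unfold branch adicInterval
  rw [inv_mul_eq_div]
  constructor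
  · gcongr; linarith [hy.1]
  · exact div_lt_div_of_pos_right (by linarith [hy.2]) hb

lemma adicInterval_subset (k : Fin b) : adicInterval b k ⊆ Set.Ico (0 : ℝ) 1 := by
  have hb : (0 : ℝ) < b := cast_base_pos
  have hk : ((k : ℕ) : ℝ) + 1 ≤ b := by exact_mod_cast k.2
  intro x hx
  exact ⟨le_trans (by positivity) hx.1, hx.2.trans_le ((div_le_one hb).2 hk)⟩

lemma mem_adicInterval_iff {k : ℕ} {x : ℝ} :
    x ∈ adicInterval b k ↔ b * x - k ∈ Set.Ico (0 : ℝ) 1 := by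
  have hb : (0 : ℝ) < b := cast_base_pos
  simp only [adicInterval, Set.mem_Ico, div_le_iff₀ hb, lt_div_iff₀ hb]
  constructor <;> rintro ⟨h, h'⟩ <;> constructor <;> linarith

lemma Ico_eq_iUnion_adicInterval :
    Set.Ico (0 : ℝ) 1 = ⋃ k : Fin b, adicInterval b k := by
  have hb : (0 : ℝ) < b := cast_base_pos
  refine Set.Subset.antisymm (fun x hx => ?_) (Set.iUnion_subset adicInterval_subset)
  have h0 : 0 ≤ (b : ℝ) * x := mul_nonneg hb.le hx.1
  have hlt : ⌊(b : ℝ) * x⌋₊ < b := by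
    rw [Nat.floor_lt h0]; nlinarith [hx.2]
  refine Set.mem_iUnion.2 ⟨⟨_, hlt⟩, mem_adicInterval_iff.2 ⟨?_, ?_⟩⟩
  · linarith [Nat.floor_le h0]
  · have := Nat.lt_floor_add_one ((b : ℝ) * x); dsimp only; linarith

lemma disjoint_adicInterval {j k : Fin b} (hjk : j ≠ k) {x : ℝ} (hx : x ∈ adicInterval b j) :
    x ∉ adicInterval b k := by
  rw [mem_adicInterval_iff] at *
  intro hx'
  have h1 : ((j : ℕ) : ℝ) < (k : ℕ) + 1 := by linarith [hx.1, hx'.2]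
  have h2 : ((k : ℕ) : ℝ) < (j : ℕ) + 1 := by linarith [hx.2, hx'.1]
  have h1' : (j : ℕ) < k + 1 := by exact_mod_cast h1
  have h2' : (k : ℕ) < j + 1 := by exact_mod_cast h2
  exact hjk (Fin.ext (by omega))

lemma map_branch_le (k : Fin b) :
    lam.map (branch b k) ≤ (b : ℝ≥0∞) • lam := by
  have hb : (0 : ℝ) < b := cast_base_pos
  have h := map_affine_restrict_le (b : ℝ)⁻¹ ((b : ℝ)⁻¹ * (k : ℕ)) (inv_ne_zero hb.ne')
    (A := Set.Ico 0 1) (B := Set.Ico 0 1) (fun x hx => by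
      have := adicInterval_subset k (branch_mem_adicInterval (k : ℕ) hx)
      rwa [branch, mul_add] at this)
  have e : branch b k = fun x => (b : ℝ)⁻¹ * x + (b : ℝ)⁻¹ * (k : ℕ) := by
    funext x; rw [branch, mul_add]
  rw [e]
  simpa using h

lemma quasiMeasurePreserving_branch (k : Fin b) :
    Measure.QuasiMeasurePreserving (branch b k) lam lam :=
  quasiMeasurePreserving_of_map_le_smul (measurable_branch b k) (map_branch_le k)

lemma map_expand_le (k : ℕ) :
    (volume.restrict (adicInterval b k)).map (fun x => (b : ℝ) * x - k) ≤
      ENNReal.ofReal |(b : ℝ)⁻¹| • lam :=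
  map_affine_restrict_le (b : ℝ) (-(k : ℝ)) cast_base_pos.ne' fun _ hx =>
    mem_adicInterval_iff.1 hx

lemma quasiMeasurePreserving_expand (k : ℕ) :
    Measure.QuasiMeasurePreserving (fun x => (b : ℝ) * x - k)
      (volume.restrict (adicInterval b k)) lam :=
  quasiMeasurePreserving_of_map_le_smul (by fun_prop) (map_expand_le k)

variable {p : ℝ≥0∞}

lemma memLp_comp_branch (k : Fin b) {f : ℝ → ℝ} (hf : MemLp f p lam) :
    MemLp (fun y => f (branch b k y)) p lam :=
  (hf.of_measure_le_smul (ENNReal.natCast_ne_top b) (map_branch_le k)).comp_of_map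
    (measurable_branch b k).aemeasurable

/-- The dilation operator `f ↦ f (b⁻¹ (· + k))` on `L^p([0,1))`. -/
noncomputable def dil (k : Fin b) : LpI p →ₗ[ℝ] LpI p where
  toFun f := (memLp_comp_branch k (Lp.memLp f)).toLp _
  map_add' f g := by
    apply Lp.ext
    filter_upwards [(memLp_comp_branch k (Lp.memLp (f + g))).coeFn_toLp,
      (memLp_comp_branch k (Lp.memLp f)).coeFn_toLp, (memLp_comp_branch k (Lp.memLp g)).coeFn_toLp,
      Lp.coeFn_add ((memLp_comp_branch k (Lp.memLp f)).toLp _)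
        ((memLp_comp_branch k (Lp.memLp g)).toLp _),
      (quasiMeasurePreserving_branch k).ae_eq (Lp.coeFn_add f g)] with y h1 h2 h3 h4 h5
    rw [h1, h4, Pi.add_apply, h2, h3]
    exact h5
  map_smul' a f := by
    apply Lp.ext
    filter_upwards [(memLp_comp_branch k (Lp.memLp (a • f))).coeFn_toLp,
      (memLp_comp_branch k (Lp.memLp f)).coeFn_toLp,
      Lp.coeFn_smul a ((memLp_comp_branch k (Lp.memLp f)).toLp _),
      (quasiMeasurePreserving_branch k).ae_eq (Lp.coeFn_smul a f)] with y h1 h2 h4 h5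
    rw [h1, RingHom.id_apply, h4, Pi.smul_apply, h2]
    exact h5

lemma coeFn_dil (k : Fin b) (f : LpI p) : dil k f =ᵐ[lam] fun y => f (branch b k y) :=
  (memLp_comp_branch k (Lp.memLp f)).coeFn_toLp

lemma ae_lam_of_adicInterval {P : ℝ → Prop}
    (h : ∀ k : Fin b, ∀ᵐ x ∂volume.restrict (adicInterval b k), P x) : ∀ᵐ x ∂lam, P x := by
  have := (ae_restrict_iUnion_iff (μ := volume) (fun k : Fin b => adicInterval b k) P).2 h
  rwa [← Ico_eq_iUnion_adicInterval] at this

lemma branch_expand (k : ℕ) (x : ℝ) : branch b k ((b : ℝ) * x - k) = x := by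
  have hb : (b : ℝ) ≠ 0 := cast_base_pos.ne'
  rw [branch]; field_simp; ring

lemma expand_branch (k : ℕ) (y : ℝ) : (b : ℝ) * branch b k y - k = y := by
  have hb : (b : ℝ) ≠ 0 := cast_base_pos.ne'
  rw [branch]; field_simp; ring

/-- The images of the branches tile [0,1), and x ↦ b x - k undoes the k-th branch on its tile
without charging null sets. -/
lemma dil_injective {f g : LpI p} (h : ∀ k : Fin b, dil k f = dil k g) : f = g := by
  apply Lp.ext
  refine ae_lam_of_adicInterval (b := b) fun k => ?_
  have h1 : (fun y => f (branch b k y)) =ᵐ[lam] fun y => g (branch b k y) :=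
    (coeFn_dil k f).symm.trans (by rw [h k]; exact coeFn_dil k g)
  filter_upwards [(quasiMeasurePreserving_expand (k : ℕ)).ae_eq h1] with x hx
  simpa only [Function.comp, branch_expand] using hx

lemma memLp_indicator_expand (k : Fin b) {f : ℝ → ℝ} (hf : MemLp f p lam) :
    MemLp ((adicInterval b k).indicator fun x => f ((b : ℝ) * x - (k : ℕ))) p lam := by
  rw [memLp_indicator_iff_restrict (measurableSet_adicInterval b k),
    Measure.restrict_restrict (measurableSet_adicInterval b k),
    Set.inter_eq_self_of_subset_left (adicInterval_subset k)]
  exact (hf.of_measure_le_smul ENNReal.ofReal_ne_top (map_expand_le (k : ℕ))).comp_of_map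
    (by fun_prop)

/-- Rescaled copies of the `h k` are glued on the disjoint b-adic intervals; in L^p no compatibility
at the end points is needed. -/
lemma exists_dil_eq (h : Fin b → LpI p) : ∃ f : LpI p, ∀ k, dil k f = h k := by
  have hF : MemLp (fun x => ∑ k : Fin b, (adicInterval b k).indicator
      (fun x => h k ((b : ℝ) * x - (k : ℕ))) x) p lam :=
    memLp_finsetSum _ fun k _ => memLp_indicator_expand k (Lp.memLp (h k))
  refine ⟨hF.toLp _, fun k => Lp.ext ?_⟩
  refine (coeFn_dil k _).trans
    (((quasiMeasurePreserving_branch k).ae_eq hF.coeFn_toLp).trans ?_)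
  filter_upwards [ae_restrict_mem (μ := volume) (measurableSet_Ico (a := (0 : ℝ)) (b := 1))]
    with y hy
  have hm : branch b k y ∈ adicInterval b k := branch_mem_adicInterval (k : ℕ) hy
  rw [Function.comp, Finset.sum_eq_single k, Set.indicator_of_mem hm, expand_branch]
  · intro j _ hj
    exact Set.indicator_of_notMem (disjoint_adicInterval hj.symm hm) _
  · simp

/-- The image of Lebesgue measure under a branch is at most b times Lebesgue measure, so the
operator norm is at most b^{1/p}. -/
lemma continuous_dil [Fact (1 ≤ p)] (k : Fin b) : Continuous (dil (p := p) k) := by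
  refine (LinearMap.mkContinuous (dil (p := p) k) ((b : ℝ≥0∞) ^ (1 / p).toReal).toReal
    fun f => ?_).continuous
  have hfin : (b : ℝ≥0∞) ^ (1 / p).toReal ≠ ∞ :=
    ENNReal.rpow_ne_top_of_nonneg ENNReal.toReal_nonneg (ENNReal.natCast_ne_top b)
  rw [Lp.norm_def, Lp.norm_def, ← ENNReal.toReal_mul]
  refine ENNReal.toReal_mono (ENNReal.mul_ne_top hfin (Lp.eLpNorm_ne_top f)) ?_
  rw [eLpNorm_congr_ae (coeFn_dil k f)]
  have hm := (Lp.memLp f).of_measure_le_smul (ENNReal.natCast_ne_top b) (map_branch_le k)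
  calc eLpNorm (f ∘ branch b k) p lam = eLpNorm f p (lam.map (branch b k)) :=
        (eLpNorm_map_measure hm.1 (measurable_branch b k).aemeasurable).symm
    _ ≤ eLpNorm f p ((b : ℝ≥0∞) • lam) := eLpNorm_mono_measure _ (map_branch_le k)
    _ = _ := by
      rw [eLpNorm_smul_measure_of_ne_zero (Nat.cast_ne_zero.2 (NeZero.ne b)), smul_eq_mul]

end

/-! ### Iterated dilations and the realized functions -/

lemma coeFn_sum_smul {p : ℝ≥0∞} {ι : Type*} (s : Finset ι) (c : ι → ℝ) (f : ι → LpI p) :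
    ⇑(∑ i ∈ s, c i • f i) =ᵐ[lam] fun y => ∑ i ∈ s, c i * f i y := by
  classical
  induction s using Finset.induction_on with
  | empty =>
    simp only [Finset.sum_empty]
    exact Lp.coeFn_zero _ _ _
  | insert a s ha ih =>
    simp only [Finset.sum_insert ha]
    filter_upwards [Lp.coeFn_add (c a • f a) (∑ i ∈ s, c i • f i), Lp.coeFn_smul (c a) (f a), ih]
      with y h1 h2 h3
    rw [h1, Pi.add_apply, h2, h3]
    rfl

lemma TensorNetwork.coeFn_tensor {b m : ℕ} {p : ℝ≥0∞} (v : TensorNetwork b m)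
    (φ : Fin m → LpI p) (i : Fin v.level → Fin b) :
    ⇑(∑ k : ((ν : Fin (v.l + 1)) → Fin (v.rank ν)), (v.first (i (0 : Fin (v.l + 1))) (k 0) *
      (∏ ν : Fin v.l, v.core ν (i (Fin.succ ν)) (k ν.castSucc) (k ν.succ))) •
        ∑ q : Fin m, v.last (k (Fin.last v.l)) q • φ q) =ᵐ[lam] v.tensor (fun q => φ q) i := by
  simp only [Finset.smul_sum, smul_smul]
  rw [← Fintype.sum_prod_type' (f := fun (k : (ν : Fin (v.l + 1)) → Fin (v.rank ν)) q =>
    (v.first (i (0 : Fin (v.l + 1))) (k 0) *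
      (∏ ν : Fin v.l, v.core ν (i (Fin.succ ν)) (k ν.castSucc) (k ν.succ)) *
      v.last (k (Fin.last v.l)) q) • φ q)]
  refine (coeFn_sum_smul _ _ _).trans (Filter.Eventually.of_forall fun y => ?_)
  simp only [tensor]
  rw [← Fintype.sum_prod_type']

section

variable {b : ℕ} [NeZero b] {p : ℝ≥0∞}

/-- The composition of the dilations `dil (w 0)`, `dil (w 1)`, …, in this order. -/
noncomputable def wordDil : (n : ℕ) → (Fin n → Fin b) → (LpI p →ₗ[ℝ] LpI p)
  | 0, _ => LinearMap.id
  | n + 1, w => (wordDil n (Fin.tail w)).comp (dil (w 0))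

@[simp] lemma wordDil_zero (w : Fin 0 → Fin b) (f : LpI p) : wordDil 0 w f = f := rfl

lemma wordDil_succ (n : ℕ) (w : Fin (n + 1) → Fin b) (f : LpI p) :
    wordDil (n + 1) w f = wordDil n (Fin.tail w) (dil (w 0) f) := rfl

lemma wordDil_cons (n : ℕ) (k : Fin b) (w : Fin n → Fin b) (f : LpI p) :
    wordDil (n + 1) (Fin.cons k w : Fin (n + 1) → Fin b) f = wordDil n w (dil k f) := by
  rw [wordDil_succ, Fin.tail_cons, Fin.cons_zero]

lemma conv_succ (n : ℕ) (w : Fin (n + 1) → Fin b) (y : ℝ) :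
    conv b (n + 1) w y = branch b (w 0) (conv b n (Fin.tail w) y) := by
  have hb : (b : ℝ) ≠ 0 := cast_base_pos.ne'
  simp only [conv, branch, Fin.sum_univ_succ, Fin.tail, mul_add, Finset.mul_sum, Fin.val_zero,
    Fin.val_succ, zero_add, pow_one]
  have h1 : ∀ x : Fin n, (((w x.succ : ℕ) : ℝ)) / (b : ℝ) ^ ((x : ℕ) + 1 + 1) =
      (b : ℝ)⁻¹ * (((w x.succ : ℕ) : ℝ) / (b : ℝ) ^ ((x : ℕ) + 1)) := fun x => by
    rw [pow_succ (b : ℝ) ((x : ℕ) + 1)]; field_simp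
  have h2 : y / (b : ℝ) ^ (n + 1) = (b : ℝ)⁻¹ * (y / (b : ℝ) ^ n) := by
    rw [pow_succ]; field_simp
  rw [Finset.sum_congr rfl fun x _ => h1 x, h2]
  ring

lemma quasiMeasurePreserving_conv (n : ℕ) (w : Fin n → Fin b) :
    Measure.QuasiMeasurePreserving (conv b n w) lam lam := by
  induction n with
  | zero =>
    have : conv b 0 w = id := by funext y; simp [conv]
    rw [this]; exact Measure.QuasiMeasurePreserving.id _
  | succ n ih =>
    have : conv b (n + 1) w = branch b (w 0) ∘ conv b n (Fin.tail w) := by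
      funext y; exact conv_succ n w y
    rw [this]; exact (quasiMeasurePreserving_branch (w 0)).comp (ih _)

lemma coeFn_wordDil (n : ℕ) (w : Fin n → Fin b) (f : LpI p) :
    wordDil n w f =ᵐ[lam] fun y => f (conv b n w y) := by
  induction n generalizing f with
  | zero => simp [conv]
  | succ n ih =>
    rw [wordDil_succ]
    refine (ih (Fin.tail w) (dil (w 0) f)).trans ?_
    filter_upwards [(quasiMeasurePreserving_conv n (Fin.tail w)).ae_eq (coeFn_dil (w 0) f)]
      with y hy
    rw [conv_succ]
    exact hy

lemma wordDil_injective (n : ℕ) {f g : LpI p}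
    (h : ∀ w : Fin n → Fin b, wordDil n w f = wordDil n w g) : f = g := by
  induction n generalizing f g with
  | zero => exact h Fin.elim0
  | succ n ih =>
    refine dil_injective (b := b) fun k => ih fun w => ?_
    rw [← wordDil_cons, ← wordDil_cons, h]

namespace TensorNetwork

variable {m : ℕ}

lemma realizes_iff_wordDil (v : TensorNetwork b m) (φ : Fin m → LpI p) (f : LpI p) :
    v.Realizes φ f ↔ ∀ i : Fin (v.l + 1) → Fin b, wordDil (v.l + 1) i f =
      ∑ k : ((ν : Fin (v.l + 1)) → Fin (v.rank ν)), (v.first (i 0) (k 0) *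
        (∏ ν : Fin v.l, v.core ν (i (Fin.succ ν)) (k ν.castSucc) (k ν.succ))) •
          ∑ q : Fin m, v.last (k (Fin.last v.l)) q • φ q := by
  refine forall_congr' fun i => ⟨fun h => Lp.ext ?_, fun h => ?_⟩
  · exact (coeFn_wordDil _ i f).trans (h.trans (coeFn_tensor v φ i).symm)
  · exact (coeFn_wordDil _ i f).symm.trans
      ((Filter.EventuallyEq.of_eq
      (congrArg (fun u : LpI p => (u : ℝ → ℝ)) h)).trans (coeFn_tensor v φ i))

end TensorNetwork

/-- Iterating the one-step relations `hg` along a word multiplies out the cores; this turns chains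
of functions into the tensor train formula. -/
lemma wordDil_sum_smul (l : ℕ) (rank : Fin (l + 1) → ℕ)
    (core : (ν : Fin l) → Fin b → Fin (rank ν.castSucc) → Fin (rank ν.succ) → ℝ)
    (g : (ν : Fin (l + 1)) → Fin (rank ν) → LpI p)
    (hg : ∀ ν i k, dil i (g ν.castSucc k) = ∑ k', core ν i k k' • g ν.succ k')
    (x : Fin (rank 0) → ℝ) (w : Fin l → Fin b) :
    wordDil l w (∑ k, x k • g 0 k) = ∑ k : ((ν : Fin (l + 1)) → Fin (rank ν)),
      (x (k 0) * ∏ ν : Fin l, core ν (w ν) (k ν.castSucc) (k ν.succ)) •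
        g (Fin.last l) (k (Fin.last l)) := by
  induction l with
  | zero =>
    simp only [wordDil_zero, Finset.univ_eq_empty, Finset.prod_empty, mul_one]
    exact (Fintype.sum_equiv (Equiv.piUnique fun ν : Fin 1 => Fin (rank ν)) _ _
      fun k => rfl).symm
  | succ l ih =>
    -- The first core is absorbed into the coefficient vector, which is why `x` must be arbitrary in
    -- the induction.
    have key := ih (fun ν => rank ν.succ) (fun ν => core ν.succ) (fun ν => g ν.succ)
      (fun ν i k => hg ν.succ i k)
      (fun k1 => ∑ k0, x k0 * core 0 (w 0) k0 k1) (Fin.tail w)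
    have h1 : dil (w 0) (∑ k, x k • g 0 k) =
        ∑ k1, (∑ k0, x k0 * core 0 (w 0) k0 k1) • g (Fin.succ 0) k1 := by
      have h0 : ∀ k, dil (w 0) (g 0 k) = ∑ k', core 0 (w 0) k k' • g (Fin.succ 0) k' :=
        fun k => hg 0 (w 0) k
      simp only [map_sum, map_smul, h0, Finset.smul_sum, smul_smul, Finset.sum_smul]
      rw [Finset.sum_comm]
    rw [wordDil_succ, h1]
    refine key.trans ?_
    rw [← (Fin.consEquiv fun ν : Fin (l + 2) => Fin (rank ν)).sum_comp, Fintype.sum_prod_type,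
      Finset.sum_comm]
    refine Finset.sum_congr rfl fun k _ => ?_
    rw [Finset.sum_mul, Finset.sum_smul]
    refine Finset.sum_congr rfl fun k0 _ => ?_
    rw [Fin.prod_univ_succ, ← mul_assoc]
    rfl

namespace TensorNetwork

variable {m : ℕ}

lemma realizes_of_chain (v : TensorNetwork b m) (φ : Fin m → LpI p) (f : LpI p)
    (g : (ν : Fin (v.l + 1)) → Fin (v.rank ν) → LpI p)
    (hfirst : ∀ i, dil i f = ∑ k, v.first i k • g 0 k)
    (hcore : ∀ ν i k, dil i (g (Fin.castSucc ν) k) = ∑ k', v.core ν i k k' • g (Fin.succ ν) k')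
    (hlast : ∀ k, g (Fin.last v.l) k = ∑ q, v.last k q • φ q) : v.Realizes φ f := by
  rw [realizes_iff_wordDil]
  intro i
  rw [wordDil_succ, hfirst, wordDil_sum_smul v.l v.rank v.core g hcore]
  simp only [hlast, Fin.tail]

lemma Realizes.unique {v : TensorNetwork b m} {φ : Fin m → LpI p} {f f' : LpI p}
    (h : v.Realizes φ f) (h' : v.Realizes φ f') : f = f' := by
  rw [realizes_iff_wordDil] at h h'
  exact wordDil_injective _ fun w => by rw [h, h']

/-- The families are built from the last core backwards, gluing at each level a function with
prescribed dilations. The function obtained at the end is realized by the same network, so it equals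
`f` by uniqueness. -/
lemma Realizes.exists_chain {v : TensorNetwork b m} {φ : Fin m → LpI p} {f : LpI p}
    (h : v.Realizes φ f) : ∃ g : (ν : Fin (v.l + 1)) → Fin (v.rank ν) → LpI p,
      (∀ i, dil i f = ∑ k, v.first i k • g 0 k) ∧
      (∀ ν i k, dil i (g (Fin.castSucc ν) k) = ∑ k', v.core ν i k k' • g (Fin.succ ν) k') ∧
      (∀ k, g (Fin.last v.l) k = ∑ q, v.last k q • φ q) := by
  choose G hG using fun h : Fin b → LpI p => exists_dil_eq h
  let g : (ν : Fin (v.l + 1)) → Fin (v.rank ν) → LpI p :=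
    Fin.reverseInduction (fun k => ∑ q, v.last k q • φ q)
      (fun ν g' k => G fun i => ∑ k', v.core ν i k k' • g' k')
  have hcore : ∀ ν i k, dil i (g (Fin.castSucc ν) k) =
      ∑ k', v.core ν i k k' • g (Fin.succ ν) k' := fun ν i k => by
    simp only [g, Fin.reverseInduction_castSucc, hG]
  have hlast : ∀ k, g (Fin.last v.l) k = ∑ q, v.last k q • φ q := fun k => by
    simp only [g, Fin.reverseInduction_last]
  have hf : f = G fun i => ∑ k, v.first i k • g 0 k :=
    h.unique (realizes_of_chain v φ _ g (fun i => hG _ i) hcore hlast)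
  exact ⟨g, fun i => by rw [hf]; exact hG _ i, hcore, hlast⟩

end TensorNetwork

end

/-! ### The spans of iterated dilations and the ranks of a function -/

section

variable {b : ℕ} [NeZero b] {p : ℝ≥0∞}

variable (b) in
/-- The span of all `n`-fold dilations of `f`; its dimension is the `n`-th minimal rank of `f`. -/
noncomputable def orbitSpan (n : ℕ) (f : LpI p) : Submodule ℝ (LpI p) :=
  Submodule.span ℝ (Set.range fun w : Fin n → Fin b => wordDil n w f)

variable (b) in
/-- The `n`-th minimal rank of `f`. -/
noncomputable def minRank (n : ℕ) (f : LpI p) : ℕ := Module.finrank ℝ (orbitSpan b n f)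

instance (n : ℕ) (f : LpI p) : FiniteDimensional ℝ (orbitSpan b n f) :=
  FiniteDimensional.span_of_finite ℝ (Set.finite_range _)

lemma orbitSpan_le_iff {n : ℕ} {f : LpI p} {V : Submodule ℝ (LpI p)} :
    orbitSpan b n f ≤ V ↔ ∀ w : Fin n → Fin b, wordDil n w f ∈ V := by
  rw [orbitSpan, Submodule.span_le, Set.range_subset_iff]; rfl

lemma wordDil_mem_orbitSpan (n : ℕ) (w : Fin n → Fin b) (f : LpI p) :
    wordDil n w f ∈ orbitSpan b n f := Submodule.subset_span ⟨w, rfl⟩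

lemma orbitSpan_zero (f : LpI p) : orbitSpan b 0 f = Submodule.span ℝ {f} := by
  rw [orbitSpan]; congr 1; ext g; simp [eq_comm]

lemma orbitSpan_succ (n : ℕ) (f : LpI p) :
    orbitSpan b (n + 1) f = ⨆ k : Fin b, orbitSpan b n (dil k f) := by
  refine le_antisymm (orbitSpan_le_iff.2 fun w => ?_) (iSup_le fun k => orbitSpan_le_iff.2
    fun w => ?_)
  · exact Submodule.mem_iSup_of_mem (w 0) (wordDil_mem_orbitSpan n _ _)
  · rw [← wordDil_cons]; exact wordDil_mem_orbitSpan _ _ _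

/-- `orbitSpan_succ` splits off the dilation applied first. This bound and `orbitSpan_succ_le` split
off the one applied last, as needed to pass from one core to the next. -/
lemma map_dil_orbitSpan_le (n : ℕ) (k : Fin b) (f : LpI p) :
    (orbitSpan b n f).map (dil k) ≤ orbitSpan b (n + 1) f := by
  induction n generalizing f with
  | zero =>
    rw [orbitSpan_succ]
    refine le_trans ?_ (le_iSup _ k)
    simp [orbitSpan_zero, Submodule.map_span]
  | succ n ih =>
    rw [orbitSpan_succ n, Submodule.map_iSup, orbitSpan_succ (n + 1)]
    exact iSup_mono fun j => ih _

lemma orbitSpan_succ_le (n : ℕ) (f : LpI p) :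
    orbitSpan b (n + 1) f ≤ ⨆ k : Fin b, (orbitSpan b n f).map (dil k) := by
  induction n generalizing f with
  | zero =>
    rw [orbitSpan_succ]
    refine iSup_mono fun k => ?_
    simp [orbitSpan_zero, Submodule.map_span]
  | succ n ih =>
    rw [orbitSpan_succ (n + 1)]
    refine iSup_le fun j => (ih _).trans (iSup_mono fun k => Submodule.map_mono ?_)
    rw [orbitSpan_succ n]
    exact le_iSup (fun k => orbitSpan b n (dil k f)) j

lemma orbitSpan_add_le (n : ℕ) (f g : LpI p) :
    orbitSpan b n (f + g) ≤ orbitSpan b n f ⊔ orbitSpan b n g :=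
  orbitSpan_le_iff.2 fun w => by
    rw [map_add]
    exact Submodule.add_mem_sup (wordDil_mem_orbitSpan n w f) (wordDil_mem_orbitSpan n w g)

lemma orbitSpan_smul_le (n : ℕ) (a : ℝ) (f : LpI p) : orbitSpan b n (a • f) ≤ orbitSpan b n f :=
  orbitSpan_le_iff.2 fun w => by
    rw [map_smul]
    exact Submodule.smul_mem _ _ (wordDil_mem_orbitSpan n w f)

lemma minRank_mono {n : ℕ} {f g : LpI p} (h : orbitSpan b n f ≤ orbitSpan b n g) :
    minRank b n f ≤ minRank b n g := Submodule.finrank_mono h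

lemma minRank_add_le (n : ℕ) (f g : LpI p) :
    minRank b n (f + g) ≤ minRank b n f + minRank b n g :=
  (Submodule.finrank_mono (orbitSpan_add_le n f g)).trans
    (Submodule.finrank_add_le_finrank_add_finrank _ _)

lemma minRank_zero_le_one (f : LpI p) : minRank b 0 f ≤ 1 := by
  rw [minRank, orbitSpan_zero]
  exact (finrank_span_le_card ({f} : Set (LpI p))).trans (by simp)

lemma coe_eq_sum_repr {V : Type*} [AddCommGroup V] [Module ℝ V] {W : Submodule ℝ V} {ι : Type*}
    [Fintype ι] (B : Module.Basis ι ℝ W) (g : W) : (g : V) = ∑ k, B.repr g k • (B k : V) := by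
  have h := congrArg W.subtype (B.sum_repr g)
  rw [map_sum] at h
  exact h.symm.trans (by simp only [map_smul, Submodule.subtype_apply])

lemma finrank_iSup_le_sum {V : Type*} [AddCommGroup V] [Module ℝ V] {ι : Type*} [Fintype ι]
    (W : ι → Submodule ℝ V) [∀ i, FiniteDimensional ℝ (W i)] :
    Module.finrank ℝ (⨆ i, W i : Submodule ℝ V) ≤ ∑ i, Module.finrank ℝ (W i) := by
  classical
  have key : ∀ s : Finset ι,
      Module.finrank ℝ (s.sup W : Submodule ℝ V) ≤ ∑ i ∈ s, Module.finrank ℝ (W i) := by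
    intro s
    induction s using Finset.induction_on with
    | empty => simp
    | insert a s ha ih =>
      rw [Finset.sup_insert, Finset.sum_insert ha]
      exact (Submodule.finrank_add_le_finrank_add_finrank _ _).trans (by omega)
  rw [← Finset.sup_univ_eq_iSup]
  exact key _

lemma minRank_succ_le (n : ℕ) (f : LpI p) : minRank b (n + 1) f ≤ b * minRank b n f := by
  refine (Submodule.finrank_mono (orbitSpan_succ_le n f)).trans
    ((finrank_iSup_le_sum _).trans ?_)
  calc ∑ k : Fin b, Module.finrank ℝ ((orbitSpan b n f).map (dil k))
      ≤ ∑ _k : Fin b, minRank b n f :=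
        Finset.sum_le_sum fun k _ => Submodule.finrank_map_le _ _
    _ = _ := by simp

lemma minRank_one_le (f : LpI p) : minRank b 1 f ≤ b :=
  (minRank_succ_le 0 f).trans (by nlinarith [minRank_zero_le_one (b := b) f])

lemma minRank_pos {n : ℕ} {f : LpI p} (hf : f ≠ 0) : 1 ≤ minRank b n f := by
  by_contra! h
  have h0 : orbitSpan b n f = ⊥ := Submodule.finrank_eq_zero.1 (by unfold minRank at h; omega)
  refine hf (wordDil_injective (b := b) n fun w => ?_)
  have := wordDil_mem_orbitSpan n w f
  rw [h0, Submodule.mem_bot] at this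
  rw [this, map_zero]

@[simp] lemma minRank_zero_right (n : ℕ) : minRank b n (0 : LpI p) = 0 := by
  have : orbitSpan b n (0 : LpI p) = ⊥ := by
    rw [eq_bot_iff, orbitSpan_le_iff]; simp
  rw [minRank, this, finrank_bot]

lemma dil_mem_of_closedUnderDilation {S : Submodule ℝ (LpI p)} (hS : ClosedUnderDilation b S)
    (k : Fin b) {f : LpI p} (hf : f ∈ S) : dil k f ∈ S := by
  obtain ⟨g, hg, h⟩ := hS f hf k k.2
  have : dil k f = g := Lp.ext ((coeFn_dil k f).trans h)
  rwa [this]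

/-- A function representable at one level is representable at every higher level; this lets two
summands be brought to a common level. -/
lemma orbitSpan_le_of_le {S : Submodule ℝ (LpI p)} (hS : ClosedUnderDilation b S) {l l' : ℕ}
    (hl : l ≤ l') {f : LpI p} (hf : orbitSpan b l f ≤ S) : orbitSpan b l' f ≤ S := by
  induction l', hl using Nat.le_induction with
  | base => exact hf
  | succ n _ ih =>
    refine (orbitSpan_succ_le n f).trans (iSup_le fun k => ?_)
    rw [Submodule.map_le_iff_le_comap]
    exact fun g hg => dil_mem_of_closedUnderDilation hS k (ih hg)

/-- This yields the lower bound on ranks: the family behind the ν-th core must span all dilations of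
that order. -/
lemma orbitSpan_le_span_of_chain {l : ℕ} {rank : Fin (l + 1) → ℕ} {f : LpI p}
    (g : (ν : Fin (l + 1)) → Fin (rank ν) → LpI p)
    (hfirst : ∀ i : Fin b, dil i f ∈ Submodule.span ℝ (Set.range (g 0)))
    (hcore : ∀ (ν : Fin l) (i : Fin b) k,
      dil i (g ν.castSucc k) ∈ Submodule.span ℝ (Set.range (g ν.succ)))
    (ν : Fin (l + 1)) : orbitSpan b (ν + 1) f ≤ Submodule.span ℝ (Set.range (g ν)) := by
  induction ν using Fin.induction with
  | zero =>
    refine (orbitSpan_succ 0 f).le.trans (iSup_le fun k => ?_)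
    rw [orbitSpan_zero, Submodule.span_le, Set.singleton_subset_iff]
    exact hfirst k
  | succ ν ih =>
    refine (orbitSpan_succ_le _ f).trans (iSup_le fun k => ?_)
    refine (Submodule.map_mono ih).trans ?_
    rw [Submodule.map_span, Submodule.span_le]
    rintro _ ⟨_, ⟨j, rfl⟩, rfl⟩
    exact hcore ν k j

/-- `F l r` is the cost of a network of level `l + 1` with ranks `r 0, …, r l`, for a cost that
depends on the level and the ranks only. -/
structure RankCost {b m : ℕ} (cost : TensorNetwork b m → ℕ) (F : ℕ → (ℕ → ℕ) → ℕ) : Prop where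
  eq : ∀ (v : TensorNetwork b m) (r : ℕ → ℕ), (∀ ν : Fin (v.l + 1), v.rank ν = r ν) →
    cost v = F v.l r
  mono : ∀ l r s, (∀ ν ≤ l, r ν ≤ s ν) → F l r ≤ F l s
  level : ∀ l r, (∀ ν ≤ l, 1 ≤ r ν) → l + 1 ≤ F l r
  zero : ∀ l, F l 0 = 0
  -- The hypotheses record what is known for the minimal ranks `r`, `s` of two functions of levels l
  -- + 1 ≤ l' + 1: growth by a factor at most b, ranks of the first function at most m from its own
  -- level on, and l' + 1 ≤ n when the second function is non-zero.
  add : ∃ c, ∀ l l' n r s, l ≤ l' → (∀ ν, r (ν + 1) ≤ b * r ν) → r 0 ≤ b →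
    (∀ ν, s (ν + 1) ≤ b * s ν) → s 0 ≤ b → (∀ ν, l ≤ ν → r ν ≤ m) → l' + 1 ≤ n →
    F l r ≤ n → F l' s ≤ n → F l' (r + s) ≤ c * n

variable {S : Submodule ℝ (LpI p)}
  (φ : Module.Basis (Fin (Module.finrank ℝ S)) ℝ S)

/-- The ranks of any realizing network dominate the minimal ranks. Conversely, coordinates in bases
of the orbit spans give a network with exactly the minimal ranks at every position. -/
lemma RankCost.mem_Phi_iff {cost : TensorNetwork b (Module.finrank ℝ S) → ℕ}
    {F : ℕ → (ℕ → ℕ) → ℕ} (hF : RankCost cost F) {n : ℕ} {f : LpI p} :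
    f ∈ Phi cost (fun q => (φ q : LpI p)) n ↔
      ∃ l, orbitSpan b (l + 1) f ≤ S ∧ F l (fun ν => minRank b (ν + 1) f) ≤ n := by
  constructor
  · rintro ⟨v, hv, hr⟩
    obtain ⟨g, h1, h2, h3⟩ := hr.exists_chain
    have key := orbitSpan_le_span_of_chain (f := f) g
      (fun i => by
        rw [h1]
        exact Submodule.sum_mem _ fun k _ =>
          Submodule.smul_mem _ _ (Submodule.subset_span ⟨k, rfl⟩))
      (fun ν i k => by
        rw [h2]
        exact Submodule.sum_mem _ fun k _ =>
          Submodule.smul_mem _ _ (Submodule.subset_span ⟨k, rfl⟩))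
    refine ⟨v.l, (key (Fin.last v.l)).trans ?_, ?_⟩
    · rw [Submodule.span_le]
      rintro _ ⟨k, rfl⟩
      rw [h3]
      exact Submodule.sum_mem _ fun q _ => Submodule.smul_mem _ _ (φ q).2
    · refine le_trans (hF.mono _ _
        -- The value 0 beyond the level is harmless: `mono` and `eq` only inspect indices up to
        -- `v.l`.
        (fun ν => if h : ν < v.l + 1 then v.rank ⟨ν, h⟩ else 0) fun ν hν => ?_)
        ((hF.eq v _ fun ν => ?_).symm.le.trans hv)
      · have hν' : ν < v.l + 1 := by omega
        rw [dif_pos hν']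
        have : FiniteDimensional ℝ (Submodule.span ℝ (Set.range (g ⟨ν, hν'⟩))) :=
          FiniteDimensional.span_of_finite ℝ (Set.finite_range _)
        refine (Submodule.finrank_mono (key ⟨ν, hν'⟩)).trans ?_
        exact (finrank_range_le_card _).trans (by simp)
      · rw [dif_pos ν.2]
  · rintro ⟨l, hl, hn⟩
    let B : (ν : ℕ) → Module.Basis (Fin (minRank b ν f)) ℝ (orbitSpan b ν f) :=
      fun ν => Module.finBasis ℝ (orbitSpan b ν f)
    have hdil : ∀ (ν : ℕ) (i : Fin b) {g : LpI p}, g ∈ orbitSpan b ν f →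
        dil i g ∈ orbitSpan b (ν + 1) f := fun ν i g hg =>
      map_dil_orbitSpan_le ν i f (Submodule.mem_map_of_mem hg)
    have hf0 : f ∈ orbitSpan b 0 f := by
      rw [orbitSpan_zero]; exact Submodule.mem_span_singleton_self f
    let v : TensorNetwork b (Module.finrank ℝ S) :=
      { l := l
        rank := fun ν => minRank b (ν + 1) f
        first := fun i k => (B 1).repr ⟨dil i f, hdil 0 i hf0⟩ k
        core := fun ν i k k' =>
          (B (ν + 1 + 1)).repr ⟨dil i (B (ν + 1) k : LpI p), hdil _ i (B (ν + 1) k).2⟩ k'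
        last := fun k q => φ.repr ⟨B (l + 1) k, hl (B (l + 1) k).2⟩ q }
    refine ⟨v, (hF.eq v _ fun ν => rfl).le.trans hn, ?_⟩
    refine v.realizes_of_chain _ _ (fun ν k => (B (ν + 1) k : LpI p)) (fun i => ?_)
      (fun ν i k => ?_) (fun k => ?_)
    · exact coe_eq_sum_repr (B 1) ⟨dil i f, hdil 0 i hf0⟩
    · exact coe_eq_sum_repr (B (ν + 1 + 1))
        ⟨dil i (B (ν + 1) k : LpI p), hdil _ i (B (ν + 1) k).2⟩
    · exact coe_eq_sum_repr φ ⟨B (l + 1) k, hl (B (l + 1) k).2⟩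

end

/-! ### The properties (P1)-(P4) for costs that depend on the ranks only -/

section

lemma Phi_mono {b m : ℕ} {p : ℝ≥0∞} (cost : TensorNetwork b m → ℕ) (φ : Fin m → LpI p) :
    P2 (Phi cost φ) :=
  fun n _ ⟨v, hv, hr⟩ => ⟨v, hv.trans n.le_succ, hr⟩

variable {b : ℕ} [NeZero b] {p : ℝ≥0∞}

lemma sum_range_le_add (r : ℕ → ℕ) {l l' m : ℕ} (hl : l ≤ l') (hr : ∀ ν, l ≤ ν → r ν ≤ m) :
    ∑ ν ∈ Finset.range (l' + 1), r ν ≤ ∑ ν ∈ Finset.range (l + 1), r ν + m * (l' + 1) := by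
  obtain ⟨k, rfl⟩ := Nat.exists_eq_add_of_le hl
  rw [show l + k + 1 = l + 1 + k by ring, Finset.sum_range_add]
  gcongr
  calc ∑ i ∈ Finset.range k, r (l + 1 + i) ≤ ∑ _i ∈ Finset.range k, m :=
        Finset.sum_le_sum fun i _ => hr _ (by omega)
    _ = m * k := by simp [mul_comm]
    _ ≤ m * (l + 1 + k) := by gcongr; omega

lemma rankCost_costN (b m : ℕ) : RankCost (TensorNetwork.costN (b := b) (m := m))
    (fun l r => ∑ ν ∈ Finset.range (l + 1), r ν) where
  eq v r h := by
    rw [TensorNetwork.costN, Finset.sum_range]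
    exact Finset.sum_congr rfl fun ν _ => h ν
  mono l r s h := Finset.sum_le_sum fun ν hν => h ν (by simp at hν; omega)
  level l r h := by
    calc l + 1 = ∑ _ν ∈ Finset.range (l + 1), 1 := by simp
      _ ≤ _ := Finset.sum_le_sum fun ν hν => h ν (by simp at hν; omega)
  zero l := by simp
  add := by
    -- Each function contributes n, and lengthening the shorter one adds at most m (l' + 1) ≤ m n.
    refine ⟨m + 2, fun l l' n r s hl _ _ _ _ hm hn hr hs => ?_⟩
    have h := sum_range_le_add r hl hm
    simp only [Pi.add_apply, Finset.sum_add_distrib]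
    nlinarith

/-- Growth by at most b gives r_{ν+1}² ≤ b r_ν r_{ν+1}. Together with `sum_mul_succ_le` this
replaces products of neighbouring ranks by squares, for which the sum of two rank sequences is easy
to bound. -/
lemma sum_sq_le {b : ℕ} (m : ℕ) (r : ℕ → ℕ) (hr : ∀ ν, r (ν + 1) ≤ b * r ν) (h0 : r 0 ≤ b)
    (l : ℕ) : ∑ ν ∈ Finset.range (l + 1), r ν ^ 2 ≤
      b * r 0 + b * (∑ ν ∈ Finset.range l, r ν * r (ν + 1)) + r l * m := by
  rw [Finset.sum_range_succ', Finset.mul_sum]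
  have h1 : ∑ ν ∈ Finset.range l, r (ν + 1) ^ 2 ≤
      ∑ ν ∈ Finset.range l, b * (r ν * r (ν + 1)) :=
    Finset.sum_le_sum fun ν _ => by nlinarith [hr ν]
  have h2 : r 0 ^ 2 ≤ b * r 0 := by nlinarith
  omega

lemma sum_mul_succ_le (t : ℕ → ℕ) (l : ℕ) :
    ∑ ν ∈ Finset.range l, t ν * t (ν + 1) ≤ 2 * ∑ ν ∈ Finset.range (l + 1), t ν ^ 2 := by
  have h1 : ∑ ν ∈ Finset.range l, t ν * t (ν + 1) ≤
      ∑ ν ∈ Finset.range l, t ν ^ 2 + ∑ ν ∈ Finset.range l, t (ν + 1) ^ 2 := by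
    rw [← Finset.sum_add_distrib]
    refine Finset.sum_le_sum fun ν _ => ?_
    rcases le_total (t ν) (t (ν + 1)) with h | h <;> nlinarith
  have h2 := Finset.sum_range_succ (fun ν => t ν ^ 2) l
  have h3 := Finset.sum_range_succ' (fun ν => t ν ^ 2) l
  omega

lemma rankCost_costC (b m : ℕ) [NeZero b] : RankCost (TensorNetwork.costC (b := b) (m := m))
    (fun l r => b * r 0 + b * (∑ ν ∈ Finset.range l, r ν * r (ν + 1)) + r l * m) where
  eq v r h := by
    rw [TensorNetwork.costC, Finset.sum_range, h 0, h (Fin.last v.l)]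
    simp [h]
  mono l r s h := by
    have h1 : ∑ ν ∈ Finset.range l, r ν * r (ν + 1) ≤ ∑ ν ∈ Finset.range l, s ν * s (ν + 1) :=
      Finset.sum_le_sum fun ν hν => by
        simp only [Finset.mem_range] at hν
        exact Nat.mul_le_mul (h ν (by omega)) (h (ν + 1) (by omega))
    have h2 := h 0 (by omega)
    have h3 := h l le_rfl
    gcongr
  level l r h := by
    have hb : 1 ≤ b := NeZero.one_le
    have h1 : l ≤ ∑ ν ∈ Finset.range l, r ν * r (ν + 1) := by
      calc l = ∑ _ν ∈ Finset.range l, 1 := by simp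
        _ ≤ _ := Finset.sum_le_sum fun ν hν => by
          simp only [Finset.mem_range] at hν
          exact Nat.mul_le_mul (h ν (by omega)) (h (ν + 1) (by omega))
    have h2 := h 0 (by omega)
    nlinarith
  zero l := by simp
  add := by
    -- From (r + s)² ≤ 2r² + 2s², with n for each function and m² n for the lengthening, the squares
    -- sum to at most 2(2 + m²) n; the factor 3b + m converts squares back to the cost.
    refine ⟨(3 * b + m) * (2 * (2 + m ^ 2)), fun l l' n r s hl hr hr0 hs hs0 hm hn hrn hsn => ?_⟩
    have hr2 := (sum_sq_le m r hr hr0 l).trans hrn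
    have hs2 := (sum_sq_le m s hs hs0 l').trans hsn
    have hr3 := sum_range_le_add (fun ν => r ν ^ 2) (m := m ^ 2) hl
      fun ν hν => Nat.pow_le_pow_left (hm ν hν) 2
    set t := r + s with ht
    set Q := ∑ ν ∈ Finset.range (l' + 1), t ν ^ 2 with hQ
    have hQn : Q ≤ 2 * (2 + m ^ 2) * n := by
      have : Q ≤ ∑ ν ∈ Finset.range (l' + 1), (2 * r ν ^ 2 + 2 * s ν ^ 2) :=
        Finset.sum_le_sum fun ν _ => by
          simp only [ht, Pi.add_apply]
          exact (add_sq_le (a := r ν) (b := s ν)).trans (by ring_nf; rfl)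
      rw [Finset.sum_add_distrib, ← Finset.mul_sum, ← Finset.mul_sum] at this
      nlinarith [Nat.mul_le_mul_left (m ^ 2) hn]
    have hmem : ∀ ν ≤ l', t ν ≤ Q := fun ν hν => by
      refine (Nat.le_self_pow two_ne_zero (t ν)).trans ?_
      exact Finset.single_le_sum (f := fun ν => t ν ^ 2) (fun _ _ => Nat.zero_le _)
        (Finset.mem_range.2 (by omega))
    have h1 := sum_mul_succ_le t l'
    have h2 := hmem 0 (by omega)
    have h3 := hmem l' le_rfl
    calc _ ≤ b * Q + b * (2 * Q) + Q * m := by gcongr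
      _ = (3 * b + m) * Q := by ring
      _ ≤ (3 * b + m) * (2 * (2 + m ^ 2) * n) := by gcongr
      _ = _ := by ring

variable {S : Submodule ℝ (LpI p)} (φ : Module.Basis (Fin (Module.finrank ℝ S)) ℝ S)
  {cost : TensorNetwork b (Module.finrank ℝ S) → ℕ} {F : ℕ → (ℕ → ℕ) → ℕ}

lemma minRank_le_finrank [FiniteDimensional ℝ S] {n : ℕ} {f : LpI p} (h : orbitSpan b n f ≤ S) :
    minRank b n f ≤ Module.finrank ℝ S := Submodule.finrank_mono h

lemma RankCost.zero_mem (hF : RankCost cost F) (n : ℕ) :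
    (0 : LpI p) ∈ Phi cost (fun q => (φ q : LpI p)) n := by
  refine (hF.mem_Phi_iff φ).2 ⟨0, orbitSpan_le_iff.2 (by simp), ?_⟩
  simp only [minRank_zero_right]
  exact (hF.zero 0).le.trans (Nat.zero_le _)

lemma RankCost.level_le (hF : RankCost cost F) {l : ℕ} {f : LpI p} (hf : f ≠ 0) :
    l + 1 ≤ F l (fun ν => minRank b (ν + 1) f) :=
  hF.level _ _ fun _ _ => minRank_pos hf

lemma RankCost.p1 (hF : RankCost cost F) : P1 (Phi cost (fun q => (φ q : LpI p))) := by
  refine ⟨hF.zero_mem φ, Set.Subset.antisymm (fun f hf => ?_) fun f hf => ?_⟩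
  · obtain ⟨l, -, hl⟩ := (hF.mem_Phi_iff φ).1 hf
    by_contra h
    have := hF.level_le (l := l) h
    omega
  · rw [Set.mem_singleton_iff.1 hf]; exact hF.zero_mem φ 0

lemma p3_of_smul_subset {X : Type*} [AddCommGroup X] [Module ℝ X] {Φ : ℕ → Set X}
    (h : ∀ (a : ℝ) (n : ℕ), ∀ f ∈ Φ n, a ≠ 0 → a • f ∈ Φ n) : P3 Φ := by
  intro a ha n
  refine Set.Subset.antisymm ?_ fun f hf => ?_
  · rintro _ ⟨f, hf, rfl⟩
    exact h a n f hf ha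
  · exact ⟨a⁻¹ • f, h _ n f hf (inv_ne_zero ha), smul_inv_smul₀ ha f⟩

lemma RankCost.p3 (hF : RankCost cost F) : P3 (Phi cost (fun q => (φ q : LpI p))) := by
  refine p3_of_smul_subset fun a n f hf _ => ?_
  obtain ⟨l, hl, hn⟩ := (hF.mem_Phi_iff φ).1 hf
  refine (hF.mem_Phi_iff φ).2 ⟨l, (orbitSpan_smul_le _ a f).trans hl, le_trans ?_ hn⟩
  exact hF.mono _ _ _ fun ν _ => minRank_mono (orbitSpan_smul_le _ a f)

lemma mem_of_p2 {X : Type*} {Φ : ℕ → Set X} (h : P2 Φ) {m n : ℕ} (hmn : m ≤ n) : Φ m ⊆ Φ n :=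
  monotone_nat_of_le_succ (f := Φ) h hmn

lemma RankCost.p4 (hS : ClosedUnderDilation b S) (hF : RankCost cost F) :
    P4 (Phi cost (fun q => (φ q : LpI p))) := by
  have : FiniteDimensional ℝ S := Module.Finite.of_basis φ
  obtain ⟨c, hc⟩ := hF.add
  have hn : ∀ n, n ≤ (c + 1) * n := fun n => by nlinarith
  -- The constant c + 1, not c, ensures n ≤ (c + 1) n, which covers a zero summand; there the level
  -- is not controlled by n.
  refine ⟨c + 1, fun n => ?_⟩
  have key : ∀ f g : LpI p, f ≠ 0 → g ≠ 0 → ∀ l l', l ≤ l' → orbitSpan b (l + 1) f ≤ S →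
      F l (fun ν => minRank b (ν + 1) f) ≤ n → orbitSpan b (l' + 1) g ≤ S →
      F l' (fun ν => minRank b (ν + 1) g) ≤ n →
      f + g ∈ Phi cost (fun q => (φ q : LpI p)) ((c + 1) * n) := by
    intro f g hf hg l l' hl hfS hfn hgS hgn
    have hfS' : ∀ ν, l ≤ ν → orbitSpan b (ν + 1) f ≤ S := fun ν hν =>
      orbitSpan_le_of_le hS (by omega) hfS
    refine (hF.mem_Phi_iff φ).2 ⟨l', (orbitSpan_add_le _ f g).trans (sup_le (hfS' l' hl) hgS), ?_⟩
    refine (hF.mono _ _ _ fun ν _ => minRank_add_le (ν + 1) f g).trans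
      ((hc l l' n _ _ hl (fun ν => minRank_succ_le (ν + 1) f) (minRank_one_le f)
      (fun ν => minRank_succ_le (ν + 1) g) (minRank_one_le g)
      (fun ν hν => minRank_le_finrank (hfS' ν hν))
      ((hF.level_le hg).trans hgn) hfn hgn).trans (by nlinarith))
  rintro _ ⟨f, hf, g, hg, rfl⟩
  dsimp only
  by_cases hf0 : f = 0
  · rw [hf0, zero_add]; exact mem_of_p2 (Phi_mono _ _) (hn n) hg
  by_cases hg0 : g = 0
  · rw [hg0, add_zero]; exact mem_of_p2 (Phi_mono _ _) (hn n) hf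
  obtain ⟨l, hl, hln⟩ := (hF.mem_Phi_iff φ).1 hf
  obtain ⟨l', hl', hln'⟩ := (hF.mem_Phi_iff φ).1 hg
  rcases le_total l l' with h | h
  · exact key f g hf0 hg0 l l' h hl hln hl' hln'
  · rw [add_comm f g]; exact key g f hg0 hf0 l' l h hl' hln' hl hln

/-! ### Best approximation -/

/-- Linear independence of a finite family is an open condition, so a maximal independent subfamily
at `x` stays independent nearby. -/
lemma eventually_le_finrank_span {X ι V : Type*} [TopologicalSpace X] [NormedAddCommGroup V]
    [NormedSpace ℝ V] [Finite ι] {F : ι → X → V} (hF : ∀ i, Continuous (F i)) (x : X) :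
    ∀ᶠ y in nhds x, Module.finrank ℝ (Submodule.span ℝ (Set.range fun i => F i x)) ≤
      Module.finrank ℝ (Submodule.span ℝ (Set.range fun i => F i y)) := by
  obtain ⟨κ, a, ha, hspan, hli⟩ := exists_linearIndependent' ℝ (fun i => F i x)
  have : Finite κ := Finite.of_injective a ha
  have := Fintype.ofFinite κ
  have hc : Continuous fun y => (fun i => F (a i) y) := continuous_pi fun i => hF (a i)
  filter_upwards [hc.tendsto x |>.eventually
    (isOpen_setOfPred_linearIndependent.mem_nhds hli)] with y hy
  have : FiniteDimensional ℝ (Submodule.span ℝ (Set.range fun i => F i y)) :=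
    FiniteDimensional.span_of_finite ℝ (Set.finite_range _)
  rw [← hspan, finrank_span_eq_card hli, ← finrank_span_eq_card hy]
  refine Submodule.finrank_mono (Submodule.span_mono ?_)
  rintro _ ⟨i, rfl⟩
  exact ⟨a i, rfl⟩

variable (b) in
/-- The functions whose `n`-fold dilations belong to `S`. -/
noncomputable def wordSpace (S : Submodule ℝ (LpI p)) (n : ℕ) : Submodule ℝ (LpI p) :=
  ⨅ w : Fin n → Fin b, S.comap (wordDil n w)

lemma mem_wordSpace {n : ℕ} {f : LpI p} : f ∈ wordSpace b S n ↔ orbitSpan b n f ≤ S := by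
  simp [wordSpace, orbitSpan_le_iff]

/-- The n-fold dilations embed this space into a finite power of `S`. -/
lemma finiteDimensional_wordSpace [FiniteDimensional ℝ S] (n : ℕ) :
    FiniteDimensional ℝ (wordSpace b S n) := by
  let T : wordSpace b S n →ₗ[ℝ] ((Fin n → Fin b) → S) :=
    LinearMap.pi fun w => ((wordDil n w).comp (wordSpace b S n).subtype).codRestrict S
      fun f => orbitSpan_le_iff.1 (mem_wordSpace.1 f.2) w
  refine FiniteDimensional.of_injective T fun f g h => Subtype.ext
    (wordDil_injective (b := b) n fun w => ?_)
  exact congrArg Subtype.val (congrFun h w)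

variable [Fact (1 ≤ p)]

lemma continuous_wordDil (n : ℕ) (w : Fin n → Fin b) : Continuous (wordDil (p := p) n w) := by
  induction n with
  | zero => exact continuous_id
  | succ n ih => exact (ih _).comp (continuous_dil _)

variable (b) in
lemma eventually_minRank_le (n : ℕ) (f : LpI p) :
    ∀ᶠ g in nhds f, minRank b n f ≤ minRank b n g :=
  eventually_le_finrank_span (fun w => continuous_wordDil n w) f

lemma isClosed_wordSpace [FiniteDimensional ℝ S] (n : ℕ) :
    IsClosed (wordSpace b S n : Set (LpI p)) := by
  rw [wordSpace, Submodule.coe_iInf]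
  exact isClosed_iInter fun w => (Submodule.closed_of_finiteDimensional S).preimage
    (continuous_wordDil n w)

/-- Only points at distance at most ‖f - a‖ compete, and inside `V` these form a compact subset of
`A`. -/
lemma exists_best_approximation {X : Type*} [NormedAddCommGroup X] [NormedSpace ℝ X]
    (V : Submodule ℝ X) [FiniteDimensional ℝ V] {A : Set X} (hA : IsClosed A) (hAV : A ⊆ V)
    (hne : A.Nonempty) (f : X) : ∃ φ ∈ A, ∀ ψ ∈ A, ‖f - φ‖ ≤ ‖f - ψ‖ := by
  obtain ⟨a, ha⟩ := hne
  have hK : IsCompact (A ∩ Metric.closedBall f ‖f - a‖) := by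
    have : ProperSpace V := FiniteDimensional.proper ℝ V
    have hB : IsClosed (((↑) : V → X) ⁻¹' (A ∩ Metric.closedBall f ‖f - a‖)) :=
      (hA.inter Metric.isClosed_closedBall).preimage continuous_subtype_val
    have hbd : Bornology.IsBounded (((↑) : V → X) ⁻¹' (A ∩ Metric.closedBall f ‖f - a‖)) := by
      refine (Metric.isBounded_closedBall (x := (0 : V)) (r := ‖f‖ + ‖f - a‖)).subset
        fun v hv => ?_
      have h1 := hv.2
      rw [Metric.mem_closedBall, dist_eq_norm] at h1
      rw [mem_closedBall_zero_iff]
      calc ‖(v : X)‖ = ‖f + (v - f)‖ := by rw [add_sub_cancel]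
        _ ≤ _ := (norm_add_le _ _).trans (by gcongr)
    have := (Metric.isCompact_of_isClosed_isBounded hB hbd).image continuous_subtype_val
    rwa [Set.image_preimage_eq_of_subset] at this
    rw [Subtype.range_coe]
    exact Set.inter_subset_left.trans hAV
  obtain ⟨φ, hφ, hmin⟩ := hK.exists_isMinOn (f := fun x => ‖f - x‖)
    ⟨a, ha, by rw [Metric.mem_closedBall, dist_comm, dist_eq_norm]⟩ (by fun_prop)
  refine ⟨φ, hφ.1, fun ψ hψ => ?_⟩
  by_cases h : ψ ∈ Metric.closedBall f ‖f - a‖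
  · exact hmin ⟨hψ, h⟩
  · rw [Metric.mem_closedBall, dist_comm, dist_eq_norm, not_le] at h
    have : ‖f - φ‖ ≤ ‖f - a‖ := by
      have := hφ.2
      rwa [Metric.mem_closedBall, dist_comm, dist_eq_norm] at this
    exact this.trans h.le

/-- A monotone function of finitely many lower semicontinuous integer ranks has closed sublevel
sets. -/
lemma RankCost.isClosed_level (hF : RankCost cost F) [FiniteDimensional ℝ S] (l n : ℕ) :
    IsClosed {f : LpI p | orbitSpan b (l + 1) f ≤ S ∧
      F l (fun ν => minRank b (ν + 1) f) ≤ n} := by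
  have hset : {f : LpI p | orbitSpan b (l + 1) f ≤ S ∧ F l (fun ν => minRank b (ν + 1) f) ≤ n} =
      (wordSpace b S (l + 1) : Set (LpI p)) ∩ {f | F l (fun ν => minRank b (ν + 1) f) ≤ n} := by
    ext f
    simp only [Set.mem_inter_iff, SetLike.mem_coe, mem_wordSpace, Set.mem_ofPred_eq]
  rw [hset]
  refine (isClosed_wordSpace (l + 1)).inter ?_
  refine ⟨isOpen_iff_mem_nhds.2 fun f hf => ?_⟩
  have hev : ∀ᶠ g in nhds f, ∀ ν ∈ Finset.range (l + 1),
      minRank b (ν + 1) f ≤ minRank b (ν + 1) g :=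
    (Filter.eventually_all_finset _).2 fun ν _ => eventually_minRank_le b (ν + 1) f
  filter_upwards [hev] with g hg hgn
  exact hf ((hF.mono _ _ _ fun ν hν => hg ν (Finset.mem_range.2 (by omega))).trans hgn)

lemma RankCost.p6 (hS : ClosedUnderDilation b S) (hF : RankCost cost F) :
    P6 (Phi cost (fun q => (φ q : LpI p))) := by
  have : FiniteDimensional ℝ S := Module.Finite.of_basis φ
  intro n f
  have : FiniteDimensional ℝ (wordSpace b S (n + 1)) := finiteDimensional_wordSpace (n + 1)
  -- A non-zero function of cost at most n has l + 1 ≤ n, so finitely many levels suffice. The range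
  -- goes up to n so that `l = 0` remains available for the zero function when n = 0.
  have hEq : Phi cost (fun q => (φ q : LpI p)) n = ⋃ l ∈ Finset.range (n + 1),
      {f : LpI p | orbitSpan b (l + 1) f ≤ S ∧ F l (fun ν => minRank b (ν + 1) f) ≤ n} := by
    ext g
    simp only [Set.mem_iUnion, exists_prop, hF.mem_Phi_iff φ, Set.mem_ofPred_eq, Finset.mem_range]
    refine ⟨fun ⟨l, hl, hn⟩ => ?_, fun ⟨l, _, h⟩ => ⟨l, h⟩⟩
    by_cases hg : g = 0
    · subst hg
      refine ⟨0, by omega, orbitSpan_le_iff.2 (by simp), ?_⟩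
      simp only [minRank_zero_right]
      exact (hF.zero 0).le.trans (Nat.zero_le _)
    · exact ⟨l, by have := hF.level_le (l := l) hg; omega, hl, hn⟩
  refine exists_best_approximation (wordSpace b S (n + 1)) (A := Phi cost _ n) ?_ ?_
    ⟨0, hF.zero_mem φ n⟩ f
  · rw [hEq]
    exact (Finset.range (n + 1)).finite_toSet.isClosed_biUnion fun l _ => hF.isClosed_level l n
  · rw [hEq]
    refine Set.iUnion₂_subset fun l hl g hg => mem_wordSpace.2 ?_
    rw [Finset.mem_range] at hl
    exact orbitSpan_le_of_le hS (by omega) hg.1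

end

/-! ### Sparse networks -/

/-- The number of non-zero entries of an array. -/
noncomputable def nnz {α : Type*} (x : α → ℝ) : ℕ := Nat.card {e // x e ≠ 0}

section

open Classical in
lemma nnz_eq_sum {α : Type*} [Fintype α] (x : α → ℝ) : nnz x = ∑ e, if x e = 0 then 0 else 1 := by
  rw [nnz, Nat.card_eq_fintype_card, Fintype.card_subtype, Finset.card_filter]
  exact Finset.sum_congr rfl fun e _ => by by_cases h : x e = 0 <;> simp [h]

lemma nnz_le_card {α : Type*} [Fintype α] (x : α → ℝ) : nnz x ≤ Fintype.card α := by
  rw [nnz, Nat.card_eq_fintype_card]; exact Fintype.card_subtype_le _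

lemma nnz_pos {α : Type*} [Finite α] {x : α → ℝ} {e : α} (he : x e ≠ 0) : 1 ≤ nnz x := by
  have : Nonempty {e // x e ≠ 0} := ⟨⟨e, he⟩⟩
  exact Nat.card_pos

lemma nnz_mono {α : Type*} [Fintype α] {x y : α → ℝ} (h : ∀ e, y e = 0 → x e = 0) :
    nnz x ≤ nnz y := by
  classical
  rw [nnz_eq_sum, nnz_eq_sum]
  refine Finset.sum_le_sum fun e _ => ?_
  by_cases hy : y e = 0
  · simp [hy, h e hy]
  · simp only [hy, if_false]; split_ifs <;> omega

/-- The block diagonal matrix with blocks `x` and `y`. -/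
def blockDiag {r r' s s' : ℕ} (x : Fin r → Fin s → ℝ) (y : Fin r' → Fin s' → ℝ) :
    Fin (r + r') → Fin (s + s') → ℝ :=
  Fin.append (fun k => Fin.append (x k) 0) (fun k => Fin.append 0 (y k))

lemma nnz_append_columns {b r r' : ℕ} (x : Fin b → Fin r → ℝ) (y : Fin b → Fin r' → ℝ) :
    nnz (fun e : Fin b × Fin (r + r') => Fin.append (x e.1) (y e.1) e.2) =
      nnz (fun e : Fin b × Fin r => x e.1 e.2) + nnz (fun e : Fin b × Fin r' => y e.1 e.2) := by
  classical
  simp only [nnz_eq_sum, Fintype.sum_prod_type, Fin.sum_univ_add, Fin.append_left,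
    Fin.append_right, Finset.sum_add_distrib]

lemma nnz_append_rows {m r r' : ℕ} (x : Fin r → Fin m → ℝ) (y : Fin r' → Fin m → ℝ) :
    nnz (fun e : Fin (r + r') × Fin m => Fin.append x y e.1 e.2) =
      nnz (fun e : Fin r × Fin m => x e.1 e.2) + nnz (fun e : Fin r' × Fin m => y e.1 e.2) := by
  classical
  simp only [nnz_eq_sum, Fintype.sum_prod_type, Fin.sum_univ_add, Fin.append_left,
    Fin.append_right]

lemma nnz_blockDiag {b r r' s s' : ℕ} (x : Fin b → Fin r → Fin s → ℝ)
    (y : Fin b → Fin r' → Fin s' → ℝ) :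
    nnz (fun e : Fin b × Fin (r + r') × Fin (s + s') => blockDiag (x e.1) (y e.1) e.2.1 e.2.2) =
      nnz (fun e : Fin b × Fin r × Fin s => x e.1 e.2.1 e.2.2) +
        nnz (fun e : Fin b × Fin r' × Fin s' => y e.1 e.2.1 e.2.2) := by
  classical
  simp only [nnz_eq_sum, Fintype.sum_prod_type, Fin.sum_univ_add, blockDiag, Fin.append_left,
    Fin.append_right, Finset.sum_add_distrib, Pi.zero_apply, if_true, Finset.sum_const_zero,
    add_zero, zero_add]

/-- Each non-zero entry of `L` affects at most m entries of the product, for each of the b digits.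
-/
lemma nnz_mul_le {b m r : ℕ} (L : Fin r → Fin m → ℝ) (A : Fin b → Fin m → Fin m → ℝ) :
    nnz (fun e : Fin b × Fin r × Fin m => ∑ q, L e.2.1 q * A e.1 q e.2.2) ≤
      b * m * nnz (fun e : Fin r × Fin m => L e.1 e.2) := by
  classical
  simp only [nnz_eq_sum, Fintype.sum_prod_type]
  have h : ∀ (i : Fin b) (k : Fin r) (q' : Fin m),
      (if ∑ q, L k q * A i q q' = 0 then 0 else 1) ≤ ∑ q, if L k q = 0 then 0 else 1 := by
    intro i k q'
    split_ifs with h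
    · exact Nat.zero_le _
    · obtain ⟨q, -, hq⟩ := Finset.exists_ne_zero_of_sum_ne_zero h
      have hq' : L k q ≠ 0 := left_ne_zero_of_mul hq
      exact le_trans (by simp [hq']) (Finset.single_le_sum
        (f := fun q => if L k q = 0 then 0 else 1) (fun _ _ => Nat.zero_le _) (Finset.mem_univ q))
  refine (Finset.sum_le_sum fun i _ => Finset.sum_le_sum fun k _ => Finset.sum_le_sum
    fun q' _ => h i k q').trans ?_
  simp only [Finset.sum_const, Finset.card_univ, Fintype.card_fin, smul_eq_mul, ← Finset.mul_sum,
    mul_assoc, le_refl]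

variable {b : ℕ} [NeZero b] {p : ℝ≥0∞} {m : ℕ}

variable (b) in
/-- The family `g` is represented by `l` cores and a last core with at most `n` non-zero
parameters in total. -/
def SparseChain (φ : Fin m → LpI p) : ℕ → ℕ → (r : ℕ) → (Fin r → LpI p) → Prop
  | 0, n, r, g => ∃ L : Fin r → Fin m → ℝ, (∀ k, g k = ∑ q, L k q • φ q) ∧
      nnz (fun e : Fin r × Fin m => L e.1 e.2) ≤ n
  | l + 1, n, r, g => ∃ (n' r' : ℕ) (h : Fin r' → LpI p) (c : Fin b → Fin r → Fin r' → ℝ),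
      SparseChain φ l n' r' h ∧ (∀ i k, dil i (g k) = ∑ k', c i k k' • h k') ∧
      nnz (fun e : Fin b × Fin r × Fin r' => c e.1 e.2.1 e.2.2) + n' ≤ n

lemma sparseChain_of_cores (φ : Fin m → LpI p) (l : ℕ) (rank : Fin (l + 1) → ℕ)
    (core : (ν : Fin l) → Fin b → Fin (rank ν.castSucc) → Fin (rank ν.succ) → ℝ)
    (last : Fin (rank (Fin.last l)) → Fin m → ℝ)
    (g : (ν : Fin (l + 1)) → Fin (rank ν) → LpI p)
    (hcore : ∀ ν i k, dil i (g ν.castSucc k) = ∑ k', core ν i k k' • g ν.succ k')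
    (hlast : ∀ k, g (Fin.last l) k = ∑ q, last k q • φ q) :
    SparseChain b φ l (∑ ν : Fin l, nnz (fun e : Fin b × Fin (rank ν.castSucc) ×
      Fin (rank ν.succ) => core ν e.1 e.2.1 e.2.2) +
      nnz (fun e : Fin (rank (Fin.last l)) × Fin m => last e.1 e.2)) (rank 0) (g 0) := by
  induction l with
  | zero => exact ⟨last, hlast, by simp⟩
  | succ l ih =>
    refine ⟨_, _, g (Fin.succ 0), core 0, ih (fun ν => rank ν.succ) (fun ν => core ν.succ) last
      (fun ν => g ν.succ) (fun ν i k => hcore ν.succ i k) hlast, fun i k => hcore 0 i k, ?_⟩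
    rw [Fin.sum_univ_succ]
    exact (add_assoc _ _ _).symm.le

/-- With `sparseChain_of_cores`, this translates between tuples of cores with dependent rank types
and the recursive predicate, on which inductions on the level are convenient. -/
lemma SparseChain.exists_cores {φ : Fin m → LpI p} {l n r : ℕ} {h : Fin r → LpI p}
    (H : SparseChain b φ l n r h) : ∃ (rank : Fin (l + 1) → ℕ) (hr : rank 0 = r)
      (core : (ν : Fin l) → Fin b → Fin (rank ν.castSucc) → Fin (rank ν.succ) → ℝ)
      (last : Fin (rank (Fin.last l)) → Fin m → ℝ)
      (g : (ν : Fin (l + 1)) → Fin (rank ν) → LpI p),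
      (∀ k, g 0 k = h (Fin.cast hr k)) ∧
      (∀ ν i k, dil i (g ν.castSucc k) = ∑ k', core ν i k k' • g ν.succ k') ∧
      (∀ k, g (Fin.last l) k = ∑ q, last k q • φ q) ∧
      ∑ ν : Fin l, nnz (fun e : Fin b × Fin (rank ν.castSucc) ×
        Fin (rank ν.succ) => core ν e.1 e.2.1 e.2.2) +
        nnz (fun e : Fin (rank (Fin.last l)) × Fin m => last e.1 e.2) ≤ n := by
  induction l generalizing n r with
  | zero =>
    obtain ⟨L, hL, hn⟩ := H
    exact ⟨fun _ => r, rfl, fun ν => ν.elim0, L, fun _ => h, fun k => rfl, fun ν => ν.elim0, hL,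
      by simpa using hn⟩
  | succ l ih =>
    obtain ⟨n', r', h', c, H', hc, hn⟩ := H
    obtain ⟨rank, hr, core, last, g, hg, hcore, hlast, hcost⟩ := ih H'
    subst hr
    obtain rfl : h' = g 0 := funext fun k => (hg k).symm
    refine ⟨Fin.cons r rank, rfl,
      fun ν => Fin.cases (motive := fun ν : Fin (l + 1) => Fin b →
        Fin ((Fin.cons r rank : Fin (l + 2) → ℕ) ν.castSucc) →
        Fin ((Fin.cons r rank : Fin (l + 2) → ℕ) ν.succ) → ℝ) c (fun ν => core ν) ν, last,
      fun ν => Fin.cases (motive := fun ν : Fin (l + 2) =>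
        Fin ((Fin.cons r rank : Fin (l + 2) → ℕ) ν) → LpI p) h (fun ν => g ν) ν,
      fun k => rfl, fun ν => ?_, hlast, ?_⟩
    · induction ν using Fin.cases with
      | zero => exact hc
      | succ ν => exact hcore ν
    · rw [Fin.sum_univ_succ, add_assoc]
      exact (Nat.add_le_add_left hcost _).trans hn

lemma mem_Phi_costS_iff {φ : Fin m → LpI p} {n : ℕ} {f : LpI p} :
    f ∈ Phi (b := b) TensorNetwork.costS φ n ↔ ∃ (l n' r : ℕ) (h : Fin r → LpI p)
      (c : Fin b → Fin r → ℝ), SparseChain b φ l n' r h ∧ (∀ i, dil i f = ∑ k, c i k • h k) ∧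
      nnz (fun e : Fin b × Fin r => c e.1 e.2) + n' ≤ n := by
  constructor
  · rintro ⟨v, hv, hr⟩
    obtain ⟨g, h1, h2, h3⟩ := hr.exists_chain
    refine ⟨v.l, _, _, g 0, v.first, sparseChain_of_cores φ v.l v.rank v.core v.last g h2 h3, h1,
      le_trans (le_of_eq ?_) hv⟩
    rw [← add_assoc]; rfl
  · rintro ⟨l, n', r, h, c, H, hc, hn⟩
    obtain ⟨rank, hr, core, last, g, hg, hcore, hlast, hcost⟩ := H.exists_cores
    subst hr
    obtain rfl : h = g 0 := funext fun k => (hg k).symm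
    refine ⟨⟨l, rank, c, core, last⟩, le_trans ?_ hn, TensorNetwork.realizes_of_chain _ _ _ g hc
      hcore hlast⟩
    refine le_trans (le_of_eq ?_) (Nat.add_le_add_left hcost _)
    rw [← add_assoc]; rfl

lemma append_sum_smul {r r' : ℕ} (x : Fin r → ℝ) (y : Fin r' → ℝ) (h : Fin r → LpI p)
    (h' : Fin r' → LpI p) : ∑ k, Fin.append x y k • Fin.append h h' k =
      ∑ k, x k • h k + ∑ k, y k • h' k := by
  simp only [Fin.sum_univ_add, Fin.append_left, Fin.append_right]

/-- Block diagonal cores have no non-zero entries outside the two blocks, so the counts add exactly,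
with no mixed terms. -/
lemma SparseChain.append {φ : Fin m → LpI p} {l n n' r r' : ℕ} {g : Fin r → LpI p}
    {g' : Fin r' → LpI p} (H : SparseChain b φ l n r g) (H' : SparseChain b φ l n' r' g') :
    SparseChain b φ l (n + n') (r + r') (Fin.append g g') := by
  induction l generalizing n n' r r' with
  | zero =>
    obtain ⟨L, hL, hn⟩ := H
    obtain ⟨L', hL', hn'⟩ := H'
    refine ⟨Fin.append L L', fun k => ?_, (nnz_append_rows L L').le.trans (by omega)⟩
    induction k using Fin.addCases with
    | left k => simp only [Fin.append_left, hL]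
    | right k => simp only [Fin.append_right, hL']
  | succ l ih =>
    obtain ⟨n1, s, h, c, H, hc, hn⟩ := H
    obtain ⟨n1', s', h', c', H', hc', hn'⟩ := H'
    refine ⟨_, _, _, fun i => blockDiag (c i) (c' i), ih H H', fun i k => ?_,
      (Nat.add_le_add_right (nnz_blockDiag c c').le _).trans (by omega)⟩
    induction k using Fin.addCases with
    | left k => simp [blockDiag, append_sum_smul, hc]
    | right k => simp [blockDiag, append_sum_smul, hc']

/-- A non-zero function has a non-zero dilation, so it forces a non-zero entry in every core in
turn. -/
lemma SparseChain.level_le {φ : Fin m → LpI p} {l n r : ℕ} {g : Fin r → LpI p}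
    (H : SparseChain b φ l n r g) {k : Fin r} (hk : g k ≠ 0) : l + 1 ≤ n := by
  induction l generalizing n r with
  | zero =>
    obtain ⟨L, hL, hn⟩ := H
    rw [hL] at hk
    obtain ⟨q, -, hq⟩ := Finset.exists_ne_zero_of_sum_ne_zero hk
    have := nnz_pos (x := fun e : Fin r × Fin m => L e.1 e.2) (e := (k, q))
      (left_ne_zero_of_smul hq)
    omega
  | succ l ih =>
    obtain ⟨n', r', h, c, H, hc, hn⟩ := H
    obtain ⟨i, hi⟩ : ∃ i : Fin b, dil i (g k) ≠ 0 := by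
      by_contra! h0
      exact hk (dil_injective (b := b) fun i => by rw [h0, map_zero])
    rw [hc] at hi
    obtain ⟨k', -, hk'⟩ := Finset.exists_ne_zero_of_sum_ne_zero hi
    have h1 := ih H (k := k') (right_ne_zero_of_smul hk')
    have := nnz_pos (x := fun e : Fin b × Fin r × Fin r' => c e.1 e.2.1 e.2.2) (e := (i, k, k'))
      (left_ne_zero_of_smul hk')
    omega

lemma sparseChain_basis {φ : Fin m → LpI p} {A : Fin b → Fin m → Fin m → ℝ}
    (hA : ∀ i q, dil i (φ q) = ∑ q', A i q q' • φ q') (e : ℕ) :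
    SparseChain b φ e ((e + 1) * (b * m * m)) m φ := by
  induction e with
  | zero =>
    have hb : 1 ≤ b := NeZero.one_le
    refine ⟨fun k q => if k = q then 1 else 0, fun k => by simp, (nnz_le_card _).trans ?_⟩
    simp only [Fintype.card_prod, Fintype.card_fin, zero_add, one_mul]
    exact Nat.mul_le_mul_right _ (Nat.le_mul_of_pos_left _ hb)
  | succ e ih =>
    refine ⟨_, _, φ, A, ih, hA, (Nat.add_le_add_right (nnz_le_card _) _).trans (le_of_eq ?_)⟩
    simp only [Fintype.card_prod, Fintype.card_fin]
    ring

/-- Only the last core changes: multiplied by the dilation matrices `A` it becomes an ordinary core,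
costing at most b m n. Every further level carries the basis itself, at a cost of at most b m² each.
-/
lemma SparseChain.extend {φ : Fin m → LpI p} {A : Fin b → Fin m → Fin m → ℝ}
    (hA : ∀ i q, dil i (φ q) = ∑ q', A i q q' • φ q') {l l' n r : ℕ} (hl : l ≤ l')
    {g : Fin r → LpI p} (H : SparseChain b φ l n r g) :
    SparseChain b φ l' (n + b * m * n + (l' + 1) * (b * m * m)) r g := by
  induction l generalizing l' n r with
  | zero =>
    obtain ⟨L, hL, hn⟩ := H
    cases l' with
    | zero => exact ⟨L, hL, by omega⟩
    | succ e =>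
      refine ⟨_, _, φ, fun i k q' => ∑ q, L k q * A i q q', sparseChain_basis hA e,
        fun i k => ?_, ?_⟩
      · simp only [hL, map_sum, map_smul, hA, Finset.smul_sum, smul_smul, Finset.sum_smul]
        rw [Finset.sum_comm]
      · refine (Nat.add_le_add_right (nnz_mul_le L A) _).trans ?_
        have h2 := Nat.mul_le_mul_left (b * m) hn
        have h3 : (e + 1) * (b * m * m) ≤ (e + 1 + 1) * (b * m * m) := by gcongr; omega
        omega
  | succ l ih =>
    obtain ⟨n', r', h, c, H, hc, hn⟩ := H
    obtain ⟨l', rfl⟩ : ∃ k, l' = k + 1 := ⟨l' - 1, by omega⟩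
    refine ⟨_, _, h, c, ih (by omega) H, hc, ?_⟩
    have h2 := Nat.mul_le_mul_left (b * m) (show n' ≤ n by omega)
    have h3 : (l' + 1) * (b * m * m) ≤ (l' + 1 + 1) * (b * m * m) := by gcongr; omega
    omega

/-! ### Properties of the sparse family -/

lemma zero_mem_Phi_costS (φ : Fin m → LpI p) (n : ℕ) :
    (0 : LpI p) ∈ Phi (b := b) TensorNetwork.costS φ n := by
  refine mem_Phi_costS_iff.2 ⟨0, 0, 0, Fin.elim0, fun _ => Fin.elim0,
    ⟨Fin.elim0, fun k => k.elim0, ?_⟩, fun i => by simp, ?_⟩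
  · exact (nnz_le_card _).trans (by simp)
  · exact (Nat.add_le_add_right (nnz_le_card _) _).trans (by simp)

lemma p1_Phi_costS (φ : Fin m → LpI p) : P1 (Phi (b := b) TensorNetwork.costS φ) := by
  refine ⟨zero_mem_Phi_costS φ, Set.Subset.antisymm (fun f hf => ?_) fun f hf => ?_⟩
  · obtain ⟨l, n, r, h, c, -, hc, hn⟩ := mem_Phi_costS_iff.1 hf
    refine dil_injective (b := b) fun i => ?_
    rw [hc, map_zero]
    refine Finset.sum_eq_zero fun k _ => ?_
    have : c i k = 0 := by
      by_contra h0
      have := nnz_pos (x := fun e : Fin b × Fin r => c e.1 e.2) (e := (i, k)) h0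
      omega
    rw [this, zero_smul]
  · rw [Set.mem_singleton_iff.1 hf]; exact zero_mem_Phi_costS φ 0

lemma p3_Phi_costS (φ : Fin m → LpI p) : P3 (Phi (b := b) TensorNetwork.costS φ) := by
  refine p3_of_smul_subset fun a n f hf _ => ?_
  obtain ⟨l, n', r, h, c, H, hc, hn⟩ := mem_Phi_costS_iff.1 hf
  refine mem_Phi_costS_iff.2 ⟨l, n', r, h, fun i k => a * c i k, H, fun i => ?_,
    (Nat.add_le_add_right (nnz_mono fun e he => ?_) _).trans hn⟩
  · simp only [map_smul, hc, Finset.smul_sum, smul_smul]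
  · simp only [he, mul_zero]

lemma p4_Phi_costS {S : Submodule ℝ (LpI p)} (hS : ClosedUnderDilation b S)
    (φ : Module.Basis (Fin m) ℝ S) :
    P4 (Phi (b := b) TensorNetwork.costS (fun q => (φ q : LpI p))) := by
  have hA : ∀ (i : Fin b) (q : Fin m), dil i (φ q : LpI p) =
      ∑ q', φ.repr ⟨dil i (φ q : LpI p), dil_mem_of_closedUnderDilation hS i (φ q).2⟩ q' •
        (φ q' : LpI p) := fun i q => coe_eq_sum_repr φ ⟨_, _⟩
  -- Two networks of cost n, plus b m n for the modified last core, plus b m² for each of the l' + 1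
  -- ≤ n levels.
  set c := 2 + b * m + b * m * m with hc
  have hcn : ∀ n, n ≤ c * n := fun n => Nat.le_mul_of_pos_left _ (by omega)
  refine ⟨c, fun n => ?_⟩
  have key : ∀ (f g : LpI p) (l l' n₁ n₂ r r' : ℕ) (h : Fin r → LpI p) (h' : Fin r' → LpI p)
      (x : Fin b → Fin r → ℝ) (y : Fin b → Fin r' → ℝ), g ≠ 0 → l ≤ l' →
      SparseChain b (fun q => (φ q : LpI p)) l n₁ r h →
      SparseChain b (fun q => (φ q : LpI p)) l' n₂ r' h' →
      (∀ i, dil i f = ∑ k, x i k • h k) → (∀ i, dil i g = ∑ k, y i k • h' k) →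
      nnz (fun e : Fin b × Fin r => x e.1 e.2) + n₁ ≤ n →
      nnz (fun e : Fin b × Fin r' => y e.1 e.2) + n₂ ≤ n →
      f + g ∈ Phi (b := b) TensorNetwork.costS (fun q => (φ q : LpI p)) (c * n) := by
    intro f g l l' n₁ n₂ r r' h h' x y hg hl H H' hx hy hn hn'
    refine mem_Phi_costS_iff.2 ⟨l', _, _, _, fun i => Fin.append (x i) (y i),
      (H.extend hA hl).append H', fun i => ?_, ?_⟩
    · rw [map_add, append_sum_smul, hx, hy]
    · rw [nnz_append_columns]
      have hlev : l' + 1 ≤ n := by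
        obtain ⟨i, hi⟩ : ∃ i : Fin b, dil i g ≠ 0 := by
          by_contra! h0
          exact hg (dil_injective (b := b) fun i => by rw [h0, map_zero])
        rw [hy] at hi
        obtain ⟨k', -, hk'⟩ := Finset.exists_ne_zero_of_sum_ne_zero hi
        have := H'.level_le (k := k') (right_ne_zero_of_smul hk')
        omega
      have h1 := Nat.mul_le_mul_left (b * m) (show n₁ ≤ n by omega)
      have h2 := Nat.mul_le_mul_right (b * m * m) hlev
      have h3 : c * n = n + n + b * m * n + n * (b * m * m) := by rw [hc]; ring
      omega
  rintro _ ⟨f, hf, g, hg, rfl⟩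
  dsimp only
  by_cases hf0 : f = 0
  · rw [hf0, zero_add]; exact mem_of_p2 (Phi_mono _ _) (hcn n) hg
  by_cases hg0 : g = 0
  · rw [hg0, add_zero]; exact mem_of_p2 (Phi_mono _ _) (hcn n) hf
  obtain ⟨l, n₁, r, h, x, H, hx, hn⟩ := mem_Phi_costS_iff.1 hf
  obtain ⟨l', n₂, r', h', y, H', hy, hn'⟩ := mem_Phi_costS_iff.1 hg
  rcases le_total l l' with hl | hl
  · exact key f g l l' n₁ n₂ r r' h h' x y hg0 hl H H' hx hy hn hn'
  · rw [add_comm f g]; exact key g f l' l n₂ n₁ r' r h' h y x hf0 hl H' H hy hx hn' hn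

end

/-! ### Density -/

section

/-- The step function that takes on each `b`-adic interval of level `n` the value of `g` at the
left end point. -/
noncomputable def adicStep (b n : ℕ) (g : ℝ → ℝ) (x : ℝ) : ℝ :=
  g (⌊(b : ℝ) ^ n * x⌋ / (b : ℝ) ^ n)

lemma measurable_adicStep (b n : ℕ) {g : ℝ → ℝ} (hg : Continuous g) :
    Measurable (adicStep b n g) := by
  have h : Measurable fun x : ℝ => (⌊(b : ℝ) ^ n * x⌋ : ℝ) :=
    measurable_from_top.comp (Int.measurable_floor.comp (measurable_const_mul _))
  exact hg.measurable.comp (h.div_const _)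

variable {b : ℕ} [NeZero b] {p : ℝ≥0∞}

lemma exists_pow_mul_conv_eq (n : ℕ) (w : Fin n → Fin b) :
    ∃ N : ℤ, ∀ y : ℝ, (b : ℝ) ^ n * conv b n w y = N + y := by
  induction n with
  | zero => exact ⟨0, fun y => by simp [conv]⟩
  | succ n ih =>
    obtain ⟨N, hN⟩ := ih (Fin.tail w)
    refine ⟨N + (b : ℤ) ^ n * (w 0 : ℕ), fun y => ?_⟩
    have hb : (b : ℝ) ≠ 0 := cast_base_pos.ne'
    rw [conv_succ, branch, pow_succ]
    calc (b : ℝ) ^ n * b * ((b : ℝ)⁻¹ * (conv b n (Fin.tail w) y + ((w 0 : ℕ) : ℝ)))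
        = (b : ℝ) ^ n * conv b n (Fin.tail w) y + (b : ℝ) ^ n * ((w 0 : ℕ) : ℝ) := by
          field_simp
      _ = _ := by rw [hN]; push_cast; ring

lemma abs_sub_floor_div_le (n : ℕ) (x : ℝ) :
    |⌊(b : ℝ) ^ n * x⌋ / (b : ℝ) ^ n - x| ≤ ((b : ℝ)⁻¹) ^ n := by
  have hb : (0 : ℝ) < (b : ℝ) ^ n := pow_pos cast_base_pos n
  have h1 := Int.floor_le ((b : ℝ) ^ n * x)
  have h2 := Int.lt_floor_add_one ((b : ℝ) ^ n * x)
  have h3 : (⌊(b : ℝ) ^ n * x⌋ : ℝ) / (b : ℝ) ^ n - x =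
      (⌊(b : ℝ) ^ n * x⌋ - (b : ℝ) ^ n * x) / (b : ℝ) ^ n := by field_simp
  rw [h3, abs_div, abs_of_pos hb, inv_pow, ← one_div]
  gcongr
  rw [abs_le]; constructor <;> linarith

/-- On each b-adic interval of level n the step function is constant, so its n-fold dilations are
multiples of 1. -/
lemma orbitSpan_adicStep_le {S : Submodule ℝ (LpI p)} (h1 : Lp.const p lam (1 : ℝ) ∈ S) (n : ℕ)
    {g : ℝ → ℝ} (hg : MemLp (adicStep b n g) p lam) :
    orbitSpan b n (hg.toLp _) ≤ S := by
  refine orbitSpan_le_iff.2 fun w => ?_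
  obtain ⟨N, hN⟩ := exists_pow_mul_conv_eq n w
  have : wordDil n w (hg.toLp _) = g (N / (b : ℝ) ^ n) • Lp.const p lam (1 : ℝ) := by
    apply Lp.ext
    filter_upwards [coeFn_wordDil n w (hg.toLp _),
      (quasiMeasurePreserving_conv n w).ae_eq hg.coeFn_toLp,
      Lp.coeFn_smul (g (N / (b : ℝ) ^ n)) (Lp.const p lam (1 : ℝ)),
      Lp.coeFn_const p lam (1 : ℝ),
      ae_restrict_mem (μ := volume) (measurableSet_Ico (a := (0 : ℝ)) (b := 1))]
      with y h1 h2 h3 h4 hy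
    have hfl : ⌊(b : ℝ) ^ n * conv b n w y⌋ = N := by
      rw [hN, Int.floor_eq_iff]; constructor <;> linarith [hy.1, hy.2]
    simp only [Function.comp] at h2
    rw [h1, h3, Pi.smul_apply, h4, h2, adicStep, hfl]
    simp
  rw [this]
  exact S.smul_mem _ h1

/-- Every network has finite cost, so a network found through the rank cost serves for any `cost`.
-/
lemma mem_iUnion_Phi {S : Submodule ℝ (LpI p)} (φ : Module.Basis (Fin (Module.finrank ℝ S)) ℝ S)
    (cost : TensorNetwork b (Module.finrank ℝ S) → ℕ) {l : ℕ} {f : LpI p}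
    (hf : orbitSpan b (l + 1) f ≤ S) : f ∈ ⋃ n, Phi cost (fun q => (φ q : LpI p)) n := by
  obtain ⟨v, -, hv⟩ := ((rankCost_costN b _).mem_Phi_iff φ (f := f)).2 ⟨l, hf, le_rfl⟩
  exact Set.mem_iUnion.2 ⟨cost v, v, le_rfl, hv⟩

lemma dense_iUnion_Phi [Fact (1 ≤ p)] (hp : p ≠ ∞) (hb : 2 ≤ b) {S : Submodule ℝ (LpI p)}
    (h1 : Lp.const p lam (1 : ℝ) ∈ S) (φ : Module.Basis (Fin (Module.finrank ℝ S)) ℝ S)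
    (cost : TensorNetwork b (Module.finrank ℝ S) → ℕ) :
    P5 (Phi cost (fun q => (φ q : LpI p))) := by
  have key : ∀ (g : ℝ → ℝ) (hgp : MemLp g p lam), HasCompactSupport g → Continuous g →
      hgp.toLp g ∈ closure (⋃ n, Phi cost (fun q => (φ q : LpI p)) n) := by
    intro g hgp hgc hg
    refine EMetric.mem_closure_iff.2 fun ε hε => ?_
    obtain ⟨η, hη, hηε⟩ : ∃ η : ℝ, 0 < η ∧ ENNReal.ofReal η < ε := by
      obtain ⟨η, hη, hηε⟩ := ENNReal.lt_iff_exists_nnreal_btwn.1 hε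
      exact ⟨η, by exact_mod_cast hη, by simpa using hηε⟩
    obtain ⟨δ, hδ, hgδ⟩ := Metric.uniformContinuous_iff.1
      (hgc.uniformContinuous_of_continuous hg) η hη
    have hb' : ((b : ℝ)⁻¹) < 1 := inv_lt_one_of_one_lt₀ (by exact_mod_cast hb)
    obtain ⟨l, hl⟩ := exists_pow_lt_of_lt_one hδ hb'
    -- The exponent is l + 1 because networks have level at least one.
    have hl' : ((b : ℝ)⁻¹) ^ (l + 1) < δ := lt_of_le_of_lt
      (pow_le_pow_of_le_one (inv_nonneg.2 cast_base_pos.le) hb'.le l.le_succ) hl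
    have hbd : ∀ x, ‖g x - adicStep b (l + 1) g x‖ ≤ η := fun x => by
      rw [← dist_eq_norm, dist_comm]
      refine (hgδ ?_).le
      rw [Real.dist_eq]
      exact (abs_sub_floor_div_le (l + 1) x).trans_lt hl'
    have hdiff : MemLp (g - adicStep b (l + 1) g) p lam :=
      MemLp.of_bound (hg.measurable.sub (measurable_adicStep _ _ hg)).aestronglyMeasurable η
        (Filter.Eventually.of_forall hbd)
    have hstep : MemLp (adicStep b (l + 1) g) p lam := by
      have := hgp.sub hdiff
      rwa [sub_sub_cancel] at this
    refine ⟨hstep.toLp _, mem_iUnion_Phi φ cost (orbitSpan_adicStep_le h1 (l + 1) hstep), ?_⟩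
    rw [Lp.edist_toLp_toLp]
    refine lt_of_le_of_lt (eLpNorm_le_of_ae_bound (C := η) (Filter.Eventually.of_forall hbd)) ?_
    simpa using hηε
  intro f
  rw [← closure_closure]
  refine EMetric.mem_closure_iff.2 fun ε hε => ?_
  obtain ⟨η, hη, hηε⟩ := exists_between hε
  obtain ⟨g, hgc, hfg, hg, hgp⟩ :=
    (Lp.memLp f).exists_hasCompactSupport_eLpNorm_sub_le hp hη.ne'
  refine ⟨hgp.toLp g, key g hgp hgc hg, lt_of_le_of_lt ?_ hηε⟩
  conv_lhs => rw [← Lp.toLp_coeFn f (Lp.memLp f)]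
  rw [Lp.edist_toLp_toLp]
  exact hfg

end

/-! ### Approximation classes are quasi-normed spaces -/

section

lemma ENNReal_add_rpow_le {r : ℝ} (hr : 0 ≤ r) (x y : ℝ≥0∞) :
    (x + y) ^ r ≤ 2 ^ r * (x ^ r + y ^ r) := by
  calc (x + y) ^ r ≤ (2 * max x y) ^ r := by
        refine ENNReal.rpow_le_rpow ?_ hr
        rw [two_mul]
        exact add_le_add (le_max_left _ _) (le_max_right _ _)
    _ = 2 ^ r * max x y ^ r := ENNReal.mul_rpow_of_nonneg _ _ hr
    _ ≤ _ := by
      gcongr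
      rcases le_total x y with h | h
      · rw [max_eq_right h]; exact le_add_self
      · rw [max_eq_left h]; exact le_self_add

/-- Division with remainder: every quotient occurs for exactly c values of k. -/
lemma ENNReal_tsum_div (c : ℕ) [NeZero c] (F : ℕ → ℝ≥0∞) :
    ∑' k, F (k / c) = c * ∑' n, F n := by
  calc ∑' k, F (k / c) = ∑' x : ℕ × Fin c, F x.1 :=
        (Nat.divModEquiv c).tsum_eq fun x : ℕ × Fin c => F x.1
    _ = ∑' n, ∑' _j : Fin c, F n := ENNReal.tsum_prod (f := fun n (_ : Fin c) => F n)
    _ = _ := by simp [ENNReal.tsum_mul_left]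

variable {X : Type*} [AddCommGroup X] [ENorm X] {Φ : ℕ → Set X}

lemma bestError_le {n : ℕ} {f ψ : X} (h : ψ ∈ Φ n) : bestError Φ n f ≤ ‖f - ψ‖ₑ :=
  iInf₂_le ψ h

lemma bestError_anti (h2 : P2 Φ) {m n : ℕ} (hmn : m ≤ n) (f : X) :
    bestError Φ n f ≤ bestError Φ m f :=
  biInf_mono fun _ hψ => monotone_nat_of_le_succ (f := Φ) h2 hmn hψ

lemma bestError_smul_le [Module ℝ X] (h3 : P3 Φ)
    (hsmul : ∀ (a : ℝ) (f : X), ‖a • f‖ₑ = ‖a‖ₑ * ‖f‖ₑ)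
    {a : ℝ} (ha : a ≠ 0) (n : ℕ) (f : X) :
    bestError Φ n (a • f) ≤ ‖a‖ₑ * bestError Φ n f := by
  simp only [bestError]
  rw [ENNReal.mul_iInf_of_ne (enorm_ne_zero.2 ha) enorm_ne_top]
  refine le_iInf fun ψ => ?_
  rw [ENNReal.mul_iInf_of_ne (enorm_ne_zero.2 ha) enorm_ne_top]
  refine le_iInf fun hψ => ?_
  rw [← hsmul, smul_sub]
  exact iInf₂_le (a • ψ) (h3 a ha n ▸ Set.smul_mem_smul_set hψ)

lemma bestError_smul [Module ℝ X] (h3 : P3 Φ)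
    (hsmul : ∀ (a : ℝ) (f : X), ‖a • f‖ₑ = ‖a‖ₑ * ‖f‖ₑ)
    {a : ℝ} (ha : a ≠ 0) (n : ℕ) (f : X) :
    bestError Φ n (a • f) = ‖a‖ₑ * bestError Φ n f := by
  refine le_antisymm (bestError_smul_le h3 hsmul ha n f) ?_
  have h := bestError_smul_le h3 hsmul (inv_ne_zero ha) n (a • f)
  rw [inv_smul_smul₀ ha] at h
  calc ‖a‖ₑ * bestError Φ n f ≤ ‖a‖ₑ * (‖a⁻¹‖ₑ * bestError Φ n (a • f)) := by gcongr
    _ = _ := by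
      rw [← mul_assoc, ← enorm_mul, mul_inv_cancel₀ ha, enorm_one, one_mul]

lemma bestError_zero_right (h1 : P1 Φ) (h0 : ‖(0 : X)‖ₑ = 0) (n : ℕ) :
    bestError Φ n (0 : X) = 0 := by
  have := bestError_le (f := (0 : X)) (h1.1 n)
  rw [sub_zero, h0] at this
  exact le_antisymm this zero_le

lemma bestError_zero_left (h1 : P1 Φ) (f : X) : bestError Φ 0 f = ‖f‖ₑ := by
  simp [bestError, h1.2]

lemma bestError_add_le {K : ℝ≥0∞} (hK0 : K ≠ 0) (hK : K ≠ ∞)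
    (hadd : ∀ f g : X, ‖f + g‖ₑ ≤ K * (‖f‖ₑ + ‖g‖ₑ)) {c n : ℕ}
    (hc : Φ n + Φ n ⊆ Φ (c * n)) (f g : X) :
    bestError Φ (c * n) (f + g) ≤ K * (bestError Φ n f + bestError Φ n g) := by
  have e : ∀ h : X, bestError Φ n h = ⨅ ψ : Φ n, ‖h - ψ‖ₑ := fun h => iInf_subtype'
  rw [e f, e g, ENNReal.iInf_add, ENNReal.mul_iInf_of_ne hK0 hK]
  refine le_iInf fun ψ => ?_
  rw [ENNReal.add_iInf, ENNReal.mul_iInf_of_ne hK0 hK]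
  refine le_iInf fun χ => ?_
  refine (bestError_le (hc (Set.add_mem_add ψ.2 χ.2))).trans ?_
  rw [add_sub_add_comm]
  exact hadd _ _

/-! ### Weighted errors and the quasi-norm -/

/-- `n^α E_{n-1}(f)`, with the index shifted by one. -/
noncomputable def weightedError (Φ : ℕ → Set X) (α : ℝ) (f : X) (n : ℕ) : ℝ≥0∞ :=
  ((n + 1 : ℕ) : ℝ≥0∞) ^ α * bestError Φ n f

lemma approxNorm_top (α : ℝ) (f : X) : approxNorm Φ α ∞ f = ⨆ n, weightedError Φ α f n := by
  rw [approxNorm, if_pos rfl]; rfl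

lemma approxNorm_of_ne_top (α : ℝ) {q : ℝ≥0∞} (hq : q ≠ ∞) (f : X) : approxNorm Φ α q f =
    (∑' n, weightedError Φ α f n ^ q.toReal / ((n + 1 : ℕ) : ℝ≥0∞)) ^ (1 / q.toReal) := by
  rw [approxNorm, if_neg hq]; rfl

/-- (P4) is applied at ⌊k/c⌋, since c⌊k/c⌋ ≤ k; the weight is compared through k + 1 ≤ c(⌊k/c⌋ + 1),
at the price of c^α. -/
lemma weightedError_add_le {K : ℝ≥0∞} (hK0 : K ≠ 0) (hK : K ≠ ∞)
    (hadd : ∀ f g : X, ‖f + g‖ₑ ≤ K * (‖f‖ₑ + ‖g‖ₑ)) (h2 : P2 Φ) {c : ℕ} (hc0 : 0 < c)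
    (hc : ∀ n, Φ n + Φ n ⊆ Φ (c * n)) {α : ℝ} (hα : 0 ≤ α) (f g : X) (k : ℕ) :
    weightedError Φ α (f + g) k ≤ (c : ℝ≥0∞) ^ α * K *
      (weightedError Φ α f (k / c) + weightedError Φ α g (k / c)) := by
  have h : bestError Φ k (f + g) ≤ K * (bestError Φ (k / c) f + bestError Φ (k / c) g) :=
    (bestError_anti h2 (Nat.mul_div_le k c) _).trans (bestError_add_le hK0 hK hadd (hc _) f g)
  have hk : k + 1 ≤ c * (k / c + 1) := by
    have := Nat.lt_mul_div_succ k hc0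
    omega
  calc weightedError Φ α (f + g) k ≤ ((c * (k / c + 1) : ℕ) : ℝ≥0∞) ^ α *
        (K * (bestError Φ (k / c) f + bestError Φ (k / c) g)) := by
        unfold weightedError
        gcongr
    _ = _ := by
      rw [Nat.cast_mul, ENNReal.mul_rpow_of_nonneg _ _ hα]
      unfold weightedError
      ring

lemma weightedError_smul [Module ℝ X] (h3 : P3 Φ)
    (hsmul : ∀ (a : ℝ) (f : X), ‖a • f‖ₑ = ‖a‖ₑ * ‖f‖ₑ)
    {a : ℝ} (ha : a ≠ 0) (α : ℝ) (f : X) (n : ℕ) :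
    weightedError Φ α (a • f) n = ‖a‖ₑ * weightedError Φ α f n := by
  rw [weightedError, weightedError, bestError_smul h3 hsmul ha]; ring

lemma weightedError_zero_right (h1 : P1 Φ) (h0 : ‖(0 : X)‖ₑ = 0) (α : ℝ) (n : ℕ) :
    weightedError Φ α (0 : X) n = 0 := by
  rw [weightedError, bestError_zero_right h1 h0, mul_zero]

/-- As Φ_0 = {0}, the leading term is the norm itself; this makes the approximation quasi-norm
definite. -/
lemma weightedError_zero_left (h1 : P1 Φ) (α : ℝ) (f : X) :
    weightedError Φ α f 0 = ‖f‖ₑ := by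
  simp [weightedError, bestError_zero_left h1]

lemma approxNorm_zero (h1 : P1 Φ) (h0 : ‖(0 : X)‖ₑ = 0) (α : ℝ) {q : ℝ≥0∞} (hq : 0 < q) :
    approxNorm Φ α q (0 : X) = 0 := by
  by_cases hq' : q = ∞
  · subst hq'
    simp [approxNorm_top, weightedError_zero_right h1 h0]
  · have hq0 : 0 < q.toReal := ENNReal.toReal_pos hq.ne' hq'
    rw [approxNorm_of_ne_top α hq']
    simp [weightedError_zero_right h1 h0, ENNReal.zero_rpow_of_pos hq0, hq0]

lemma enorm_eq_zero_of_approxNorm (h1 : P1 Φ) {α : ℝ} {q : ℝ≥0∞} (hq : 0 < q) {f : X}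
    (h : approxNorm Φ α q f = 0) : ‖f‖ₑ = 0 := by
  rw [← weightedError_zero_left h1 α f]
  by_cases hq' : q = ∞
  · subst hq'
    rw [approxNorm_top] at h
    exact le_antisymm ((le_iSup (weightedError Φ α f) 0).trans h.le) zero_le
  · have hq0 : 0 < q.toReal := ENNReal.toReal_pos hq.ne' hq'
    rw [approxNorm_of_ne_top α hq',
      ENNReal.rpow_eq_zero_iff_of_pos (one_div_pos.2 hq0), ENNReal.tsum_eq_zero] at h
    have := h 0
    simpa [ENNReal.rpow_eq_zero_iff_of_pos hq0] using this

lemma approxNorm_smul [Module ℝ X] (h3 : P3 Φ)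
    (hsmul : ∀ (a : ℝ) (f : X), ‖a • f‖ₑ = ‖a‖ₑ * ‖f‖ₑ)
    {a : ℝ} (ha : a ≠ 0) (α : ℝ) {q : ℝ≥0∞} (hq : 0 < q) (f : X) :
    approxNorm Φ α q (a • f) = ‖a‖ₑ * approxNorm Φ α q f := by
  by_cases hq' : q = ∞
  · subst hq'
    simp only [approxNorm_top, weightedError_smul h3 hsmul ha, ENNReal.mul_iSup]
  · have hq0 : 0 < q.toReal := ENNReal.toReal_pos hq.ne' hq'
    simp only [approxNorm_of_ne_top α hq', weightedError_smul h3 hsmul ha,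
      ENNReal.mul_rpow_of_nonneg _ _ hq0.le, mul_div_assoc, ENNReal.tsum_mul_left]
    rw [ENNReal.mul_rpow_of_nonneg _ _ (one_div_nonneg.2 hq0.le), ← ENNReal.rpow_mul,
      mul_one_div_cancel hq0.ne', ENNReal.rpow_one]

lemma exists_approxNorm_add_le {K : ℝ≥0∞} (hK0 : K ≠ 0) (hK : K ≠ ∞)
    (hadd : ∀ f g : X, ‖f + g‖ₑ ≤ K * (‖f‖ₑ + ‖g‖ₑ)) (h2 : P2 Φ) (h4 : P4 Φ)
    {α : ℝ} (hα : 0 < α) {q : ℝ≥0∞} (hq : 0 < q) : ∃ M : ℝ≥0, ∀ f g : X,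
      approxNorm Φ α q (f + g) ≤ M * (approxNorm Φ α q f + approxNorm Φ α q g) := by
  -- The constant of (P4) is enlarged to be positive, so that division by it makes sense.
  obtain ⟨c, hc⟩ : ∃ c : ℕ, ∀ n, Φ n + Φ n ⊆ Φ ((c + 1) * n) := by
    obtain ⟨c, hc⟩ := h4
    exact ⟨c, fun n => (hc n).trans
      (monotone_nat_of_le_succ (f := Φ) h2 (Nat.mul_le_mul_right n c.le_succ))⟩
  have hw := fun f g => weightedError_add_le hK0 hK hadd h2 c.succ_pos hc hα.le f g
  set C : ℝ≥0∞ := ((c + 1 : ℕ) : ℝ≥0∞) ^ α * K with hC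
  have hCtop : C ≠ ∞ := ENNReal.mul_ne_top
    (ENNReal.rpow_ne_top_of_nonneg hα.le (ENNReal.natCast_ne_top _)) hK
  suffices ∃ M : ℝ≥0∞, M ≠ ∞ ∧ ∀ f g : X,
      approxNorm Φ α q (f + g) ≤ M * (approxNorm Φ α q f + approxNorm Φ α q g) by
    obtain ⟨M, hM, h⟩ := this
    exact ⟨M.toNNReal, fun f g => by rw [ENNReal.coe_toNNReal hM]; exact h f g⟩
  by_cases hq' : q = ∞
  · subst hq'
    refine ⟨C, hCtop, fun f g => ?_⟩
    simp only [approxNorm_top]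
    refine iSup_le fun k => (hw f g k).trans ?_
    gcongr
    · exact le_iSup (weightedError Φ α f) _
    · exact le_iSup (weightedError Φ α g) _
  · have hq0 : 0 < q.toReal := ENNReal.toReal_pos hq.ne' hq'
    set s := q.toReal with hs
    have hs' : 0 ≤ 1 / s := one_div_nonneg.2 hq0.le
    -- C^s comes from the weighted errors, 2^s from splitting the s-th power of a sum, and c + 1
    -- from the multiplicity of each index.
    set D : ℝ≥0∞ := C ^ s * 2 ^ s * ((c + 1 : ℕ) : ℝ≥0∞) with hD
    have h2top : ∀ r : ℝ, 0 ≤ r → (2 : ℝ≥0∞) ^ r ≠ ∞ := fun r hr =>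
      ENNReal.rpow_ne_top_of_nonneg hr ENNReal.ofNat_ne_top
    have hDtop : D ≠ ∞ := ENNReal.mul_ne_top (ENNReal.mul_ne_top
      (ENNReal.rpow_ne_top_of_nonneg hq0.le hCtop) (h2top s hq0.le)) (ENNReal.natCast_ne_top _)
    refine ⟨D ^ (1 / s) * 2 ^ (1 / s), ENNReal.mul_ne_top
      (ENNReal.rpow_ne_top_of_nonneg hs' hDtop) (h2top _ hs'), fun f g => ?_⟩
    simp only [approxNorm_of_ne_top α hq']
    set T : X → ℕ → ℝ≥0∞ := fun f n => weightedError Φ α f n ^ s / ((n + 1 : ℕ) : ℝ≥0∞) with hT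
    have hterm : ∀ k, T (f + g) k ≤
        C ^ s * 2 ^ s * (T f (k / (c + 1)) + T g (k / (c + 1))) := fun k => by
      have h1 : weightedError Φ α (f + g) k ^ s ≤ C ^ s * (2 ^ s *
          (weightedError Φ α f (k / (c + 1)) ^ s + weightedError Φ α g (k / (c + 1)) ^ s)) := by
        refine (ENNReal.rpow_le_rpow (hw f g k) hq0.le).trans ?_
        rw [ENNReal.mul_rpow_of_nonneg _ _ hq0.le]
        gcongr
        exact ENNReal_add_rpow_le hq0.le _ _
      have h2 : ((k / (c + 1) + 1 : ℕ) : ℝ≥0∞) ≤ ((k + 1 : ℕ) : ℝ≥0∞) :=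
        Nat.cast_le.2 (Nat.add_le_add_right (Nat.div_le_self _ _) 1)
      refine (ENNReal.div_le_div h1 h2).trans (le_of_eq ?_)
      simp only [hT, div_eq_mul_inv]
      ring
    have hsum : ∑' k, T (f + g) k ≤ D * (∑' n, T f n + ∑' n, T g n) := by
      refine (ENNReal.tsum_le_tsum hterm).trans (le_of_eq ?_)
      rw [ENNReal.tsum_mul_left, ENNReal_tsum_div (c + 1) (fun n => T f n + T g n),
        ENNReal.tsum_add, ← mul_assoc]
    calc (∑' k, T (f + g) k) ^ (1 / s) ≤ (D * (∑' n, T f n + ∑' n, T g n)) ^ (1 / s) :=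
          ENNReal.rpow_le_rpow hsum hs'
      _ = D ^ (1 / s) * (∑' n, T f n + ∑' n, T g n) ^ (1 / s) :=
          ENNReal.mul_rpow_of_nonneg _ _ hs'
      _ ≤ D ^ (1 / s) * (2 ^ (1 / s) *
          ((∑' n, T f n) ^ (1 / s) + (∑' n, T g n) ^ (1 / s))) := by
          gcongr
          exact ENNReal_add_rpow_le hs' _ _
      _ = _ := (mul_assoc _ _ _).symm

/-- If `Φ` satisfies (P1)-(P4), its approximation classes are quasi-normed linear spaces. -/
theorem isQuasiNormedSpace_approxClass [Module ℝ X] {K : ℝ≥0∞} (hK0 : K ≠ 0) (hK : K ≠ ∞)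
    (hadd : ∀ f g : X, ‖f + g‖ₑ ≤ K * (‖f‖ₑ + ‖g‖ₑ))
    (hsmul : ∀ (a : ℝ) (f : X), ‖a • f‖ₑ = ‖a‖ₑ * ‖f‖ₑ) (h0 : ∀ f : X, ‖f‖ₑ = 0 ↔ f = 0)
    (h1 : P1 Φ) (h2 : P2 Φ) (h3 : P3 Φ) (h4 : P4 Φ) {α : ℝ} (hα : 0 < α) {q : ℝ≥0∞}
    (hq : 0 < q) : IsQuasiNormedSpace (approxClass Φ α q) (approxNorm Φ α q) := by
  obtain ⟨M, hM⟩ := exists_approxNorm_add_le hK0 hK hadd h2 h4 hα hq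
  have hz : approxNorm Φ α q (0 : X) = 0 := approxNorm_zero h1 ((h0 0).2 rfl) α hq
  have hs : ∀ (a : ℝ) (f : X), approxNorm Φ α q (a • f) = ‖a‖ₑ * approxNorm Φ α q f := by
    intro a f
    by_cases ha : a = 0
    · rw [ha, zero_smul, hz, enorm_zero, zero_mul]
    · exact approxNorm_smul h3 hsmul ha α hq f
  refine ⟨⟨{ carrier := approxClass Φ α q
             zero_mem' := ?_
             add_mem' := ?_
             smul_mem' := ?_ }, rfl⟩, fun f hf => hf, fun f _ => ⟨fun h => ?_, fun h => ?_⟩,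
    fun a f _ => hs a f, M, fun f _ g _ => hM f g⟩
  · exact fun {f g} hf hg => (hM f g).trans_lt
      (ENNReal.mul_lt_top ENNReal.coe_lt_top (ENNReal.add_lt_top.2 ⟨hf, hg⟩))
  · exact hz.trans_lt ENNReal.zero_lt_top
  · intro a f hf
    exact (hs a f).trans_lt (ENNReal.mul_lt_top enorm_lt_top hf)
  · exact (h0 f).1 (enorm_eq_zero_of_approxNorm h1 hq h)
  · rw [h, hz]

end

/-- Stated for the extended norm so as to cover p < 1, where L^p only has a quasi-triangle
inequality. The added 1 makes the constant visibly non-zero. -/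
lemma enorm_add_le_LpI {p : ℝ≥0∞} (f g : LpI p) :
    ‖f + g‖ₑ ≤ (p.LpAddConst + 1) * (‖f‖ₑ + ‖g‖ₑ) := by
  simp only [Lp.enorm_def]
  rw [eLpNorm_congr_ae (Lp.coeFn_add f g)]
  refine (eLpNorm_add_le' (Lp.aestronglyMeasurable f) (Lp.aestronglyMeasurable g) p).trans ?_
  gcongr
  exact le_self_add

lemma enorm_smul_LpI {p : ℝ≥0∞} (a : ℝ) (f : LpI p) : ‖a • f‖ₑ = ‖a‖ₑ * ‖f‖ₑ := by
  simp only [Lp.enorm_def]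
  rw [eLpNorm_congr_ae (Lp.coeFn_smul a f), eLpNorm_const_smul]

lemma enorm_eq_zero_LpI {p : ℝ≥0∞} (hp : 0 < p) (f : LpI p) : ‖f‖ₑ = 0 ↔ f = 0 := by
  rw [Lp.enorm_def, eLpNorm_eq_zero_iff (Lp.aestronglyMeasurable f) hp.ne',
    Lp.eq_zero_iff_ae_eq_zero]

end TTApprox

theorem mainTheorem3 (b : ℕ) (hb : 2 ≤ b) (p : ℝ≥0∞) (hp : 0 < p)
    (S : Submodule ℝ (TTApprox.LpI p)) [FiniteDimensional ℝ S]
    (hS : TTApprox.ClosedUnderDilation b S)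
    (φ : Module.Basis (Fin (Module.finrank ℝ S)) ℝ S) :
    -- (P1)-(P4) for all three families, `0 < p ≤ ∞`
    (∀ Φ ∈ ({TTApprox.PhiN b φ, TTApprox.PhiC b φ, TTApprox.PhiS b φ} :
        Set (ℕ → Set (TTApprox.LpI p))),
      TTApprox.P1 Φ ∧ TTApprox.P2 Φ ∧ TTApprox.P3 Φ ∧ TTApprox.P4 Φ) ∧
    -- (P6) for the families N and C, `1 ≤ p ≤ ∞`
    (1 ≤ p → TTApprox.P6 (TTApprox.PhiN b φ) ∧ TTApprox.P6 (TTApprox.PhiC b φ)) ∧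
    -- (P5) for all three families, `1 ≤ p < ∞` and `1 ∈ S`
    (∀ [Fact (1 ≤ p)], p ≠ ∞ → Lp.const p TTApprox.lam (1 : ℝ) ∈ S →
      TTApprox.P5 (TTApprox.PhiN b φ) ∧ TTApprox.P5 (TTApprox.PhiC b φ) ∧
        TTApprox.P5 (TTApprox.PhiS b φ)) ∧
    -- the approximation classes are quasi-normed linear spaces, `0 < p ≤ ∞`
    (∀ α : ℝ, 0 < α → ∀ q : ℝ≥0∞, 0 < q →
      ∀ Φ ∈ ({TTApprox.PhiN b φ, TTApprox.PhiC b φ, TTApprox.PhiS b φ} :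
          Set (ℕ → Set (TTApprox.LpI p))),
        TTApprox.IsQuasiNormedSpace (TTApprox.approxClass Φ α q)
          (TTApprox.approxNorm Φ α q)) := by
  have : NeZero b := ⟨by omega⟩
  have hN := TTApprox.rankCost_costN b (Module.finrank ℝ S)
  have hC := TTApprox.rankCost_costC b (Module.finrank ℝ S)
  have hP : ∀ Φ ∈ ({TTApprox.PhiN b φ, TTApprox.PhiC b φ, TTApprox.PhiS b φ} :
        Set (ℕ → Set (TTApprox.LpI p))),
      TTApprox.P1 Φ ∧ TTApprox.P2 Φ ∧ TTApprox.P3 Φ ∧ TTApprox.P4 Φ := by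
    rintro Φ (rfl | rfl | rfl)
    · exact ⟨hN.p1 φ, TTApprox.Phi_mono _ _, hN.p3 φ, hN.p4 φ hS⟩
    · exact ⟨hC.p1 φ, TTApprox.Phi_mono _ _, hC.p3 φ, hC.p4 φ hS⟩
    · exact ⟨TTApprox.p1_Phi_costS _, TTApprox.Phi_mono _ _, TTApprox.p3_Phi_costS _,
        TTApprox.p4_Phi_costS hS φ⟩
  refine ⟨hP, fun h1p => ?_, fun hp' h1 => ?_, fun α hα q hq Φ hΦ => ?_⟩
  · have : Fact (1 ≤ p) := ⟨h1p⟩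
    exact ⟨hN.p6 φ hS, hC.p6 φ hS⟩
  · exact ⟨TTApprox.dense_iUnion_Phi hp' hb h1 φ _, TTApprox.dense_iUnion_Phi hp' hb h1 φ _,
      TTApprox.dense_iUnion_Phi hp' hb h1 φ _⟩
  · obtain ⟨h1, h2, h3, h4⟩ := hP Φ hΦ
    exact TTApprox.isQuasiNormedSpace_approxClass (by simp)
      (ENNReal.add_ne_top.2 ⟨(ENNReal.LpAddConst_lt_top p).ne, ENNReal.one_ne_top⟩)
      TTApprox.enorm_add_le_LpI TTApprox.enorm_smul_LpI (TTApprox.enorm_eq_zero_LpI hp)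
      h1 h2 h3 h4 hα hq
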